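/- For an even integer $k\ge 2$ and real $y\ge 0$ let \[ M_k(y)=\frac{\alpha(-1)^{k/2-1}}{k-1}\sum_{1\le r\le 2\sqrt y}\nu(r)\sqrt{4y-r^2}\,U_{k-2}\Big(\frac{r}{2\sqrt y}\Big)+\frac{\beta}{k-1}\sqrt y-\gamma\,\delta_{k=2}\,y \] be the weight $k$ murmuration density, where $r$ runs over integers, $U_n$ is the Chebyshev polynomial with $U_n(\cos\theta)=\sin((n+1)\theta)/\sin\theta$, $\delta_{k=2}$ is $1$ if $k=2$ and $0$ otherwise, products run over primes $p$, and \[ \alpha=2\pi\prod_p\frac{1-p-2p^2+p^4}{p^4-2p^2+p},\quad \beta=2\pi\prod_p\frac{-1+p^2+p^3}{p(-1+p+p^2)},\quad \gamma=12\prod_p\frac{p(1+p)}{-1+p+p^2},\quad \nu(r)=\prod_{p\mid r}\Big(1+\frac{p^2}{p^4-2p^2-p+1}\Big). \] Let $\Phi:(0,\infty)\to\mathbb{C}$ be a smooth function with compact support in $(0,\infty)$ and with $\int_0^\infty\Phi(u)\,u\,du\neq 0$, and for $y\ge 0$ put \[ M^k_\Phi(y)=\Big(\int_0^\infty M_k(y/u)\,\Phi(u)\,u\,du\Big)\Big/\int_0^\infty\Phi(u)\,u\,du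 . \] Then $M^k_\Phi$ is continuous on $[0,\infty)$, $M^k_\Phi(0)=0$, and $M^k_\Phi(y)\to\tfrac12$ as $y\to\infty$. -/

import Mathlib

open Set Filter Topology
open scoped ContDiff

noncomputable section

namespace Murmuration

/-- The constant `α = 2π ∏_p (1 - p - 2p² + p⁴) / (p⁴ - 2p² + p)`. -/
def α : ℝ :=
  2 * Real.pi * ∏' p : Nat.Primes,
    ((1 - (p : ℝ) - 2 * (p : ℝ) ^ 2 + (p : ℝ) ^ 4) / ((p : ℝ) ^ 4 - 2 * (p : ℝ) ^ 2 + (p : ℝ)))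

/-- The constant `β = 2π ∏_p (-1 + p² + p³) / (p (-1 + p + p²))`. -/
def β : ℝ :=
  2 * Real.pi * ∏' p : Nat.Primes,
    ((-1 + (p : ℝ) ^ 2 + (p : ℝ) ^ 3) / ((p : ℝ) * (-1 + (p : ℝ) + (p : ℝ) ^ 2)))

/-- The constant `γ = 12 ∏_p p (1 + p) / (-1 + p + p²)`. -/
def γ : ℝ :=
  12 * ∏' p : Nat.Primes, ((p : ℝ) * (1 + (p : ℝ)) / (-1 + (p : ℝ) + (p : ℝ) ^ 2))

/-- The multiplicative weight `ν(r) = ∏_{p ∣ r} (1 + p² / (p⁴ - 2p² - p + 1))`. -/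
def ν (r : ℕ) : ℝ :=
  ∏ p ∈ r.primeFactors, (1 + (p : ℝ) ^ 2 / ((p : ℝ) ^ 4 - 2 * (p : ℝ) ^ 2 - (p : ℝ) + 1))

/-- The weight `k` murmuration density `M_k(y)`, for even `k ≥ 2` and real `y ≥ 0`. -/
def density (k : ℕ) (y : ℝ) : ℝ :=
  α * (-1) ^ (k / 2 - 1) / ((k : ℝ) - 1) *
      ∑ r ∈ Finset.Icc 1 ⌊2 * √y⌋₊,
        ν r * √(4 * y - (r : ℝ) ^ 2) *
          (Polynomial.Chebyshev.U ℝ ((k : ℤ) - 2)).eval ((r : ℝ) / (2 * √y))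
    + β / ((k : ℝ) - 1) * √y
    - γ * (if k = 2 then 1 else 0) * y

/-- The smoothed density
`M_Φ^k(y) = (∫₀^∞ M_k(y/u) Φ(u) u² du/u) / (∫₀^∞ Φ(u) u² du/u)`. -/
def smoothedDensity (k : ℕ) (Φ : ℝ → ℂ) (y : ℝ) : ℂ :=
  (∫ u in Ioi (0 : ℝ), (density k (y / u) : ℂ) * Φ u * (u : ℂ)) /
    ∫ u in Ioi (0 : ℝ), Φ u * (u : ℂ)

end Murmuration

end

/-!
Write `X = 2 √y`. Since `U_{k-2}(cos θ) sin θ = sin ((k - 1) θ)`, every summand of the density is a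
truncated integral of `cos ((k - 1) t)`, and the whole sum becomes
`X ∫₀^{π/2} cos ((k - 1) t) V(X cos t) dt` up to a constant, with `V(w) = ∑_{r ≤ w} ν r`.

*Arithmetic.* The Möbius transform `nuMob` of `ν` is supported on squarefree numbers and has size
about `d⁻²`. Hence `V(w) = H₁ w - H₀ / 2 + E(w)` with `H₀ = ∑ nuMob d`, `H₁ = ∑ nuMob d / d` and
`E(w) = -∑_d nuMob d ({w/d} - 1/2)`. Comparing Euler products gives `α H₀ = β` and `α π H₁ = γ`:
the last two terms of the density exactly cancel the main terms, and
`M(X²/4) = ± α X ∫₀^{π/2} cos ((k - 1) t) E(X cos t) dt` (`scaledDensity_eq_integral`).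

*Cesàro means.* The second primitive of `w ({w/d} - 1/2)` is `d³ q(x/d)` with `q` an explicit
combination of periodic primitives of the sawtooth, and `q(z) = O(min(z, z³))`. So the second
primitive of `w E(w)` is `-x²` times a Riemann-type sum `x⁻¹ ∑_d d² nuMob d · G(d/x)` with
`G(s) = s q(1/s)`. The coefficients `d² nuMob d` have a mean value `c` and `∫₀^∞ G = -1/24`, so this
second primitive is asymptotic to `c x² / 24` (`tendsto_nuErrorMoment_div_sq`). A third Euler
product, where `ζ(2) = π²/6` enters, gives `α c = 12 / π`, and
`∫₀^{π/2} cos ((2m + 1) t) / cos t dt = ± π / 2`. Therefore the second Cesàro means of the density in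
the variable `X` tend to `1/2` (`tendsto_densityMoment_div_sq`).

*Smoothing.* After the substitution `u = v⁻²` the smoothed density is an average of `M(X²/4)` at
`X = 2 √y v` against a smooth weight in `v` with compact support in `(0, ∞)`. Two integrations by
parts reduce its limit to that of the second Cesàro means (`tendsto_integral_of_cesaro`). Continuity
holds because the density itself is continuous: each summand vanishes at the point where it enters.
-/

namespace Murmuration

/-! ### The Möbius transforms of `ν` and of `d² nuMob d` -/

open ArithmeticFunction in
/-- The arithmetic function `r ↦ ν r`, with the value `0` at `r = 0`. -/
noncomputable def nuArith : ArithmeticFunction ℝ :=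
  prodPrimeFactors fun p : ℕ => 1 + (p : ℝ) ^ 2 / ((p : ℝ) ^ 4 - 2 * (p : ℝ) ^ 2 - (p : ℝ) + 1)

theorem nuArith_apply {r : ℕ} (hr : r ≠ 0) : nuArith r = ν r := by
  simp [nuArith, ArithmeticFunction.prodPrimeFactors, hr, ν]

theorem isMultiplicative_nuArith : nuArith.IsMultiplicative :=
  ArithmeticFunction.IsMultiplicative.prodPrimeFactors _

open ArithmeticFunction in
/-- The Möbius transform of `ν`, so that `ν r = ∑_{d ∣ r} nuMob d`. It is supported on squarefree
numbers and has size about `d⁻²`. -/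
noncomputable def nuMob : ArithmeticFunction ℝ := (moebius : ArithmeticFunction ℝ) * nuArith

open ArithmeticFunction in
theorem isMultiplicative_nuMob : nuMob.IsMultiplicative :=
  isMultiplicative_moebius.intCast.mul isMultiplicative_nuArith

open ArithmeticFunction in
theorem zeta_mul_moebius_mul (f : ArithmeticFunction ℝ) :
    (zeta : ArithmeticFunction ℝ) * ((moebius : ArithmeticFunction ℝ) * f) = f := by
  rw [← mul_assoc, coe_zeta_mul_coe_moebius, one_mul]

open ArithmeticFunction in
theorem sum_divisors_moebius_mul (f : ArithmeticFunction ℝ) (n : ℕ) :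
    ∑ d ∈ n.divisors, ((moebius : ArithmeticFunction ℝ) * f) d = f n := by
  rw [← coe_zeta_mul_apply, zeta_mul_moebius_mul]

open ArithmeticFunction in
theorem moebius_mul_apply_prime_pow (f : ArithmeticFunction ℝ) {p : ℕ} (hp : p.Prime) (j : ℕ) :
    ((moebius : ArithmeticFunction ℝ) * f) (p ^ (j + 1)) = f (p ^ (j + 1)) - f (p ^ j) := by
  rw [← sum_divisors_moebius_mul f (p ^ (j + 1)), ← sum_divisors_moebius_mul f (p ^ j),
    Nat.sum_divisors_prime_pow hp, Nat.sum_divisors_prime_pow hp, Finset.sum_range_succ,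
    add_sub_cancel_left]

theorem nuArith_prime_pow {p : ℕ} (hp : p.Prime) (j : ℕ) :
    nuArith (p ^ (j + 1)) =
      1 + (p : ℝ) ^ 2 / ((p : ℝ) ^ 4 - 2 * (p : ℝ) ^ 2 - (p : ℝ) + 1) := by
  rw [nuArith_apply (pow_ne_zero _ hp.ne_zero), ν, Nat.primeFactors_prime_pow (by omega) hp]
  simp

theorem nuMob_prime {p : ℕ} (hp : p.Prime) :
    nuMob p = (p : ℝ) ^ 2 / ((p : ℝ) ^ 4 - 2 * (p : ℝ) ^ 2 - (p : ℝ) + 1) := by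
  have h := moebius_mul_apply_prime_pow nuArith hp 0
  have h1 := nuArith_prime_pow hp 0
  rw [h1] at h
  simpa [nuMob, isMultiplicative_nuArith.map_one] using h

theorem nuMob_prime_pow {p : ℕ} (hp : p.Prime) (j : ℕ) : nuMob (p ^ (j + 2)) = 0 := by
  have h := moebius_mul_apply_prime_pow nuArith hp (j + 1)
  rw [nuArith_prime_pow hp, nuArith_prime_pow hp, sub_self] at h
  exact h

/-- The function `d ↦ d² nuMob d`, which has a mean value. -/
noncomputable def sqNuMob : ArithmeticFunction ℝ :=
  ⟨fun d => (d : ℝ) ^ 2 * nuMob d, by simp⟩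

theorem sqNuMob_apply (d : ℕ) : sqNuMob d = (d : ℝ) ^ 2 * nuMob d := rfl

theorem isMultiplicative_sqNuMob : sqNuMob.IsMultiplicative := by
  refine ⟨by simp [sqNuMob_apply, isMultiplicative_nuMob.map_one], fun {m n} h => ?_⟩
  simp only [sqNuMob_apply, isMultiplicative_nuMob.map_mul_of_coprime h]
  push_cast
  ring

open ArithmeticFunction in
/-- The Möbius transform of `d ↦ d² nuMob d`; the mean value of the latter is
`∑ sqNuMobMob n / n`. -/
noncomputable def sqNuMobMob : ArithmeticFunction ℝ :=
  (moebius : ArithmeticFunction ℝ) * sqNuMob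

open ArithmeticFunction in
theorem isMultiplicative_sqNuMobMob : sqNuMobMob.IsMultiplicative :=
  isMultiplicative_moebius.intCast.mul isMultiplicative_sqNuMob

theorem sum_divisors_sqNuMobMob (n : ℕ) : ∑ d ∈ n.divisors, sqNuMobMob d = sqNuMob n :=
  sum_divisors_moebius_mul _ _

theorem sqNuMobMob_prime {p : ℕ} (hp : p.Prime) : sqNuMobMob p = sqNuMob p - 1 := by
  have h := moebius_mul_apply_prime_pow sqNuMob hp 0
  simpa [sqNuMobMob, isMultiplicative_sqNuMob.map_one] using h

theorem sqNuMobMob_prime_sq {p : ℕ} (hp : p.Prime) : sqNuMobMob (p ^ 2) = - sqNuMob p := by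
  have h := moebius_mul_apply_prime_pow sqNuMob hp 1
  rw [sqNuMob_apply (p ^ (1 + 1)), nuMob_prime_pow hp 0] at h
  simpa [sqNuMobMob] using h

theorem sqNuMobMob_prime_pow {p : ℕ} (hp : p.Prime) (j : ℕ) : sqNuMobMob (p ^ (j + 3)) = 0 := by
  have h := moebius_mul_apply_prime_pow sqNuMob hp (j + 2)
  rw [sqNuMob_apply, sqNuMob_apply, nuMob_prime_pow hp (j + 1), nuMob_prime_pow hp j] at h
  simpa [sqNuMobMob] using h

/-! ### Sums of multiplicative functions -/

theorem summable_primes_inv_sq : Summable fun p : Nat.Primes => 1 / ((p : ℕ) : ℝ) ^ 2 :=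
  (Real.summable_one_div_nat_pow.mpr one_lt_two).comp_injective Subtype.val_injective

/-- A multiplicative function vanishing at cubes and higher powers of primes, and of size `O(p⁻²)`
at primes and their squares, is absolutely summable: its partial sums are at most
`∏ (1 + C / p²)`. Its sum is then an Euler product. -/
theorem summable_and_hasProd_of_multiplicative {f : ℕ → ℝ} {C : ℝ} (h0 : f 0 = 0) (h1 : f 1 = 1)
    (hmul : ∀ {m n : ℕ}, m.Coprime n → f (m * n) = f m * f n)
    (hC : ∀ p : ℕ, p.Prime → |f p| + |f (p ^ 2)| ≤ C / (p : ℝ) ^ 2)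
    (h3 : ∀ p : ℕ, p.Prime → ∀ j, f (p ^ (j + 3)) = 0) :
    Summable (fun n => |f n|) ∧
      HasProd (fun p : Nat.Primes => 1 + f p + f ((p : ℕ) ^ 2)) (∑' n, f n) := by
  have hC0 : 0 ≤ C := by
    have h := (add_nonneg (abs_nonneg _) (abs_nonneg _)).trans (hC 2 Nat.prime_two)
    by_contra hlt
    have : C / ((2 : ℕ) : ℝ) ^ 2 < 0 := div_neg_of_neg_of_pos (not_le.mp hlt) (by positivity)
    linarith
  have hs (F : ℝ → ℝ) (hF : F 0 = 0) {p : ℕ} (hp : p.Prime) :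
      HasSum (fun j => F (f (p ^ j))) (F 1 + F (f p) + F (f (p ^ 2))) := by
    have : HasSum (fun j => F (f (p ^ j))) (∑ j ∈ Finset.range 3, F (f (p ^ j))) :=
      hasSum_sum_of_ne_finset_zero fun j hj => by
        obtain ⟨i, rfl⟩ := Nat.exists_eq_add_of_le' (not_lt.mp (mt Finset.mem_range.mpr hj))
        simp only [h3 p hp i, hF]
    simpa [Finset.sum_range_succ, h1] using this
  have hsum : Summable (fun n => |f n|) := by
    have key (N : ℕ) := EulerProduct.summable_and_hasSum_smoothNumbers_prod_primesBelow_tsum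
      (f := fun n => |f n|) (by simp [h1]) (fun {m n} h => by simp only [hmul h, abs_mul])
      (fun {p} hp => by simpa using (hs abs abs_zero hp).summable) N
    have hle (N : ℕ) : ∏ p ∈ N.primesBelow, ∑' j, |f (p ^ j)| ≤
        Real.exp (C * ∑' n : ℕ, 1 / (n : ℝ) ^ 2) := by
      calc ∏ p ∈ N.primesBelow, ∑' j, |f (p ^ j)|
          ≤ ∏ p ∈ N.primesBelow, Real.exp (C * (1 / (p : ℝ) ^ 2)) := by
            refine Finset.prod_le_prod (fun p _ => tsum_nonneg fun _ => abs_nonneg _)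
              fun p hp => ?_
            have hp' := Nat.prime_of_mem_primesBelow hp
            rw [(hs abs abs_zero hp').tsum_eq, abs_one]
            have := hC p hp'
            have h2 := Real.add_one_le_exp (C * (1 / (p : ℝ) ^ 2))
            rw [mul_one_div] at h2 ⊢
            linarith
        _ = Real.exp (C * ∑ p ∈ N.primesBelow, 1 / (p : ℝ) ^ 2) := by
            rw [← Real.exp_sum, Finset.mul_sum]
        _ ≤ _ := by
            refine Real.exp_le_exp.mpr (mul_le_mul_of_nonneg_left ?_ hC0)
            exact (Real.summable_one_div_nat_pow.mpr one_lt_two).sum_le_tsum _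
              (fun _ _ => by positivity)
    refine summable_of_sum_le (fun _ => abs_nonneg _)
      (c := Real.exp (C * ∑' n : ℕ, 1 / (n : ℝ) ^ 2)) fun s => ?_
    obtain ⟨N, hN⟩ := s.exists_nat_subset_range
    refine le_trans ?_ (hle N)
    rw [← (key N).2.tsum_eq]
    have hs' : ∑ n ∈ s, |f n| = ∑ n ∈ s.filter (· ∈ N.smoothNumbers), |f n| := by
      refine (Finset.sum_filter_of_ne fun n hn hne => ?_).symm
      have hn0 : n ≠ 0 := by rintro rfl; simp [h0] at hne
      exact Nat.mem_smoothNumbers_of_lt (Nat.pos_of_ne_zero hn0)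
        (Finset.mem_range.mp (hN hn))
    rw [hs', ← Finset.sum_subtype_eq_sum_filter]
    have hsm := (key N).1
    simp only [Real.norm_eq_abs, abs_abs] at hsm
    exact hsm.sum_le_tsum _ fun _ _ => abs_nonneg _
  refine ⟨hsum, ?_⟩
  have := EulerProduct.eulerProduct_hasProd h1 hmul (by simpa using hsum) h0
  refine Eq.mp (congrArg (HasProd · _) (funext fun p => ?_)) this
  have h := (hs id rfl p.2).tsum_eq
  simpa using h

theorem third_le_denom {p : ℝ} (hp : 2 ≤ p) : p ^ 4 / 3 ≤ p ^ 4 - 2 * p ^ 2 - p + 1 := by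
  nlinarith [mul_nonneg (sub_nonneg.mpr hp) (sub_nonneg.mpr hp), sq_nonneg (p ^ 2 - 4),
    mul_nonneg (mul_nonneg (sub_nonneg.mpr hp) (sub_nonneg.mpr hp)) (sub_nonneg.mpr hp)]

theorem two_le_cast {p : ℕ} (hp : p.Prime) : (2 : ℝ) ≤ p := by exact_mod_cast hp.two_le

theorem nuMob_prime_bound {p : ℕ} (hp : p.Prime) : |nuMob p| ≤ 3 / (p : ℝ) ^ 2 := by
  have h2 := two_le_cast hp
  have hd := third_le_denom h2
  have hp4 : 0 < (p : ℝ) ^ 4 / 3 := by positivity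
  rw [nuMob_prime hp, abs_of_nonneg (div_nonneg (by positivity) (by linarith)),
    div_le_div_iff₀ (by linarith) (by positivity)]
  nlinarith

theorem summable_nuMob : Summable fun d => |nuMob d| :=
  (summable_and_hasProd_of_multiplicative (f := nuMob) (C := 3) (by simp)
    isMultiplicative_nuMob.map_one isMultiplicative_nuMob.map_mul_of_coprime
    (fun p hp => by simpa [nuMob_prime_pow hp 0] using nuMob_prime_bound hp)
    (fun p hp j => nuMob_prime_pow hp (j + 1))).1

theorem hasProd_nuMob : HasProd (fun p : Nat.Primes => 1 + nuMob p) (∑' d, nuMob d) := by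
  have := (summable_and_hasProd_of_multiplicative (f := nuMob) (C := 3) (by simp)
    isMultiplicative_nuMob.map_one isMultiplicative_nuMob.map_mul_of_coprime
    (fun p hp => by simpa [nuMob_prime_pow hp 0] using nuMob_prime_bound hp)
    (fun p hp j => nuMob_prime_pow hp (j + 1))).2
  convert this using 2 with p
  simp [nuMob_prime_pow p.2 0]

theorem hasProd_nuMob_div :
    HasProd (fun p : Nat.Primes => 1 + nuMob p / p) (∑' d : ℕ, nuMob d / d) := by
  have := (summable_and_hasProd_of_multiplicative (f := fun d => nuMob d / d) (C := 3) (by simp)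
    (by simp [isMultiplicative_nuMob.map_one])
    (fun {m n} h => by
      rw [isMultiplicative_nuMob.map_mul_of_coprime h, Nat.cast_mul, mul_div_mul_comm])
    (fun p hp => by
      have h := nuMob_prime_bound hp
      have h2 := two_le_cast hp
      simp only [nuMob_prime_pow hp 0, zero_div, abs_zero, add_zero, abs_div, Nat.abs_cast]
      exact (div_le_self (abs_nonneg _) (by linarith)).trans h)
    (fun p hp j => by simp [nuMob_prime_pow hp (j + 1)])).2
  convert this using 2 with p
  simp [nuMob_prime_pow p.2 0]

theorem summable_nuMob_div : Summable fun d : ℕ => nuMob d / d := by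
  refine Summable.of_norm_bounded summable_nuMob fun d => ?_
  rw [norm_div, Real.norm_eq_abs, Real.norm_natCast]
  rcases Nat.eq_zero_or_pos d with rfl | hd
  · simp
  · exact div_le_self (abs_nonneg _) (by exact_mod_cast hd)

theorem sqNuMob_prime {p : ℕ} (hp : p.Prime) :
    sqNuMob p = (p : ℝ) ^ 4 / ((p : ℝ) ^ 4 - 2 * (p : ℝ) ^ 2 - (p : ℝ) + 1) := by
  rw [sqNuMob_apply, nuMob_prime hp]; ring

theorem summable_and_hasProd_sqNuMobMob_div :
    Summable (fun n : ℕ => |sqNuMobMob n / n|) ∧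
      HasProd (fun p : Nat.Primes => 1 + (sqNuMob p - 1) / p - sqNuMob p / (p : ℝ) ^ 2)
        (∑' n : ℕ, sqNuMobMob n / n) := by
  have := summable_and_hasProd_of_multiplicative (f := fun d => sqNuMobMob d / d) (C := 9)
    (by simp) (by simp [isMultiplicative_sqNuMobMob.map_one])
    (fun {m n} h => by
      rw [isMultiplicative_sqNuMobMob.map_mul_of_coprime h, Nat.cast_mul, mul_div_mul_comm])
    (fun p hp => by
      have h2 := two_le_cast hp
      have hd := third_le_denom h2
      have hp4 : 0 < (p : ℝ) ^ 4 / 3 := by positivity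
      have hp0 : 0 < (p : ℝ) := by linarith
      have e1 : sqNuMob p - 1 = (2 * (p : ℝ) ^ 2 + p - 1) /
          ((p : ℝ) ^ 4 - 2 * (p : ℝ) ^ 2 - (p : ℝ) + 1) := by
        rw [sqNuMob_prime hp, div_sub_one (by linarith)]; ring
      have b2 : |sqNuMob p| ≤ 3 := by
        rw [sqNuMob_prime hp, abs_of_nonneg (div_nonneg (by positivity) (by linarith)),
          div_le_iff₀ (by linarith)]
        linarith
      simp only [sqNuMobMob_prime hp, sqNuMobMob_prime_sq hp, abs_div, abs_neg, Nat.cast_pow,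
        abs_pow, Nat.abs_cast]
      rw [show (9 : ℝ) / (p : ℝ) ^ 2 = 6 / (p:ℝ)^2 + 3 / (p : ℝ) ^ 2 by ring]
      refine add_le_add ?_ (by gcongr)
      have b3 : |sqNuMob p - 1| ≤ 6 / (p : ℝ) := by
        rw [e1, abs_of_nonneg (div_nonneg (by nlinarith) (by linarith)),
          div_le_div_iff₀ (by linarith) hp0]
        nlinarith [mul_nonneg (pow_nonneg hp0.le 3) (sub_nonneg.mpr h2),
          mul_nonneg (pow_nonneg hp0.le 2) (sub_nonneg.mpr h2)]
      calc |sqNuMob p - 1| / p ≤ (6 / (p : ℝ)) / p := by gcongr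
        _ = 6 / (p : ℝ) ^ 2 := by rw [div_div, sq])
    (fun p hp j => by simp [sqNuMobMob_prime_pow hp j])
  refine ⟨this.1, ?_⟩
  convert this.2 using 2 with p
  simp only [sqNuMobMob_prime p.2, sqNuMobMob_prime_sq p.2, Nat.cast_pow]
  ring

/-! ### Relations between the constants -/

theorem hasProd_zeta_two :
    HasProd (fun p : Nat.Primes => (1 - ((p : ℝ) ^ 2)⁻¹)⁻¹) (Real.pi ^ 2 / 6) := by
  let f : ℕ →*₀ ℝ :=
    { toFun := fun n => ((n : ℝ) ^ 2)⁻¹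
      map_zero' := by simp
      map_one' := by simp
      map_mul' := fun m n => by push_cast; rw [mul_pow, mul_inv] }
  have hf : HasSum f (Real.pi ^ 2 / 6) := by
    have := hasSum_zeta_two
    simp only [one_div] at this
    exact this
  have := EulerProduct.eulerProduct_completely_multiplicative_hasProd (f := f)
    hf.summable.norm
  rwa [hf.tsum_eq] at this

theorem hasProd_alpha :
    HasProd (fun p : Nat.Primes => ((1 - (p : ℝ) - 2 * (p : ℝ) ^ 2 + (p : ℝ) ^ 4) /
      ((p : ℝ) ^ 4 - 2 * (p : ℝ) ^ 2 + (p : ℝ)))) (α / (2 * Real.pi)) := by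
  have hm : Multipliable fun p : Nat.Primes => 1 + ((1 - 2 * (p : ℝ)) /
      ((p : ℝ) ^ 4 - 2 * (p : ℝ) ^ 2 + (p : ℝ))) := by
    refine multipliable_one_add_of_summable (Summable.of_nonneg_of_le (fun _ => norm_nonneg _)
      (fun p => ?_) (summable_primes_inv_sq.mul_left 6))
    have h2 := two_le_cast p.2
    have hd := third_le_denom h2
    have hp4 : 0 < ((p : ℕ) : ℝ) ^ 4 / 3 := by positivity
    have hp0 : 0 < ((p : ℕ) : ℝ) := by linarith
    rw [norm_div, Real.norm_eq_abs, Real.norm_eq_abs, abs_of_neg (by linarith),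
      abs_of_pos (by linarith), mul_one_div, div_le_div_iff₀ (by linarith) (by positivity)]
    nlinarith [mul_nonneg (pow_nonneg hp0.le 3) (sub_nonneg.mpr h2)]
  have e : α / (2 * Real.pi) = ∏' p : Nat.Primes, ((1 - (p : ℝ) - 2 * (p : ℝ) ^ 2 + (p : ℝ) ^ 4) /
      ((p : ℝ) ^ 4 - 2 * (p : ℝ) ^ 2 + (p : ℝ))) := by
    rw [α, mul_div_cancel_left₀ _ (by positivity)]
  rw [e]
  convert hm.hasProd using 1
  · ext p
    have h2 := two_le_cast p.2
    have hd := third_le_denom h2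
    have hp4 : 0 < ((p : ℕ) : ℝ) ^ 4 / 3 := by positivity
    rw [one_add_div (by linarith)]
    ring
  · congr 1
    ext p
    have h2 := two_le_cast p.2
    have hd := third_le_denom h2
    have hp4 : 0 < ((p : ℕ) : ℝ) ^ 4 / 3 := by positivity
    rw [one_add_div (by linarith)]
    ring

theorem alpha_mul_tsum_nuMob : α * ∑' d, nuMob d = β := by
  have h := (hasProd_alpha.mul hasProd_nuMob).tprod_eq
  have e : β = 2 * Real.pi * (α / (2 * Real.pi) * ∑' d, nuMob d) := by
    rw [← h, β]
    congr 2
    ext p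
    have h2 := two_le_cast p.2
    have hd := third_le_denom h2
    have hp4 : 0 < ((p : ℕ) : ℝ) ^ 4 / 3 := by positivity
    rw [nuMob_prime p.2, one_add_div (by linarith), div_mul_div_comm,
      div_eq_div_iff (by nlinarith) (by
        refine mul_ne_zero (by linarith) (by linarith))]
    ring
  rw [e]
  field_simp

theorem alpha_mul_pi_mul_tsum_nuMob_div : α * Real.pi * ∑' d : ℕ, nuMob d / d = γ := by
  have h := ((hasProd_alpha.mul hasProd_nuMob_div).mul hasProd_zeta_two).tprod_eq
  have e : γ = 12 * (α / (2 * Real.pi) * (∑' d : ℕ, nuMob d / d) * (Real.pi ^ 2 / 6)) := by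
    rw [← h, γ]
    congr 2
    ext p
    have h2 := two_le_cast p.2
    have hd := third_le_denom h2
    have hp4 : 0 < ((p : ℕ) : ℝ) ^ 4 / 3 := by positivity
    have hp0 : ((p : ℕ) : ℝ) ≠ 0 := by linarith
    rw [nuMob_prime p.2]
    generalize ((p : ℕ) : ℝ) = x at *
    have hB : x ^ 4 - 2 * x ^ 2 - x + 1 ≠ 0 := by linarith
    have hC : -1 + x + x ^ 2 ≠ 0 := by nlinarith
    have hD : x - 1 ≠ 0 := by linarith
    have hE : x + 1 ≠ 0 := by linarith
    rw [show x ^ 4 - 2 * x ^ 2 + x = x * (x - 1) * (-1 + x + x ^ 2) by ring,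
      show 1 - (x ^ 2)⁻¹ = (x - 1) * (x + 1) / x ^ 2 by field_simp; ring,
      show 1 - x - 2 * x ^ 2 + x ^ 4 = x ^ 4 - 2 * x ^ 2 - x + 1 by ring]
    generalize hBd : x ^ 4 - 2 * x ^ 2 - x + 1 = B at *
    generalize hCd : -1 + x + x ^ 2 = C at *
    field_simp
    rw [← hBd]
    ring
  rw [e]
  field_simp
  ring

theorem alpha_mul_tsum_sqNuMobMob_div : α * ∑' n : ℕ, sqNuMobMob n / n = 12 / Real.pi := by
  have h := ((hasProd_alpha.mul summable_and_hasProd_sqNuMobMob_div.2).mul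
    hasProd_zeta_two).tprod_eq
  have e : 1 = α / (2 * Real.pi) * (∑' d : ℕ, sqNuMobMob d / d) * (Real.pi ^ 2 / 6) := by
    rw [← h]
    refine (tprod_one (β := Nat.Primes)).symm.trans (tprod_congr fun p => ?_)
    have h2 := two_le_cast p.2
    have hd := third_le_denom h2
    have hp4 : 0 < ((p : ℕ) : ℝ) ^ 4 / 3 := by positivity
    rw [sqNuMob_prime p.2]
    generalize ((p : ℕ) : ℝ) = x at *
    have hp0 : x ≠ 0 := by linarith
    have hB : x ^ 4 - 2 * x ^ 2 - x + 1 ≠ 0 := by linarith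
    have hC : -1 + x + x ^ 2 ≠ 0 := by nlinarith
    have hD : x - 1 ≠ 0 := by linarith
    have hE : x + 1 ≠ 0 := by linarith
    rw [show x ^ 4 - 2 * x ^ 2 + x = x * (x - 1) * (-1 + x + x ^ 2) by ring,
      show 1 - (x ^ 2)⁻¹ = (x - 1) * (x + 1) / x ^ 2 by field_simp; ring,
      show 1 - x - 2 * x ^ 2 + x ^ 4 = x ^ 4 - 2 * x ^ 2 - x + 1 by ring]
    generalize hBd : x ^ 4 - 2 * x ^ 2 - x + 1 = B at *
    generalize hCd : -1 + x + x ^ 2 = C at *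
    field_simp
    rw [← hBd, ← hCd]
    ring
  have hpi := Real.pi_pos
  field_simp at e ⊢
  linarith

/-! ### Iterated primitives of the sawtooth function -/

/-- The sawtooth function `{u} - 1/2`. -/
noncomputable def saw (u : ℝ) : ℝ := Int.fract u - 1 / 2

/-- The continuous periodic primitive of `saw`; the constant `1 / 12` makes its mean zero. -/
noncomputable def saw2 (z : ℝ) : ℝ := (∫ u in (0 : ℝ)..z, saw u) + 1 / 12

/-- The primitive of `saw2` vanishing at `0`; it is periodic with mean zero. -/
noncomputable def saw3 (z : ℝ) : ℝ := ∫ u in (0 : ℝ)..z, saw2 u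

/-- The primitive of `saw3` vanishing at `0`; it is periodic. -/
noncomputable def saw4 (z : ℝ) : ℝ := ∫ u in (0 : ℝ)..z, saw3 u

theorem periodic_primitive {φ : ℝ → ℝ} (hφ : Function.Periodic φ 1)
    (hint : ∀ a b, IntervalIntegrable φ MeasureTheory.volume a b)
    (h0 : ∫ u in (0 : ℝ)..1, φ u = 0) :
    Function.Periodic (fun z => ∫ u in (0 : ℝ)..z, φ u) 1 := by
  intro z
  have := hφ.intervalIntegral_add_eq_add 0 z hint
  simpa [h0] using this

theorem measurable_saw : Measurable saw := measurable_fract.sub_const _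

theorem abs_saw_le (u : ℝ) : |saw u| ≤ 1 / 2 := by
  have h0 := Int.fract_nonneg u
  have h1 := Int.fract_lt_one u
  rw [saw, abs_le]
  constructor <;> linarith

theorem intervalIntegrable_saw (a b : ℝ) : IntervalIntegrable saw MeasureTheory.volume a b := by
  rw [intervalIntegrable_iff]
  exact MeasureTheory.Measure.integrableOn_of_bounded (M := 1 / 2)
    measure_Ioc_lt_top.ne measurable_saw.aestronglyMeasurable
    (.of_forall fun u => abs_saw_le u)

theorem continuous_saw2 : Continuous saw2 :=
  (intervalIntegral.continuous_primitive intervalIntegrable_saw 0).add_const _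

theorem continuous_saw3 : Continuous saw3 :=
  intervalIntegral.continuous_primitive (fun _ _ => continuous_saw2.intervalIntegrable _ _) 0

theorem continuous_saw4 : Continuous saw4 :=
  intervalIntegral.continuous_primitive (fun _ _ => continuous_saw3.intervalIntegrable _ _) 0

theorem saw2_eq {z : ℝ} (h0 : 0 ≤ z) (h1 : z ≤ 1) : saw2 z = z ^ 2 / 2 - z / 2 + 1 / 12 := by
  have : ∫ u in (0 : ℝ)..z, saw u = ∫ u in (0 : ℝ)..z, (u - 1 / 2) := by
    rw [intervalIntegral.integral_of_le h0, intervalIntegral.integral_of_le h0,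
      MeasureTheory.integral_Ioc_eq_integral_Ioo, MeasureTheory.integral_Ioc_eq_integral_Ioo]
    refine MeasureTheory.setIntegral_congr_fun measurableSet_Ioo fun u hu => ?_
    rw [saw, Int.fract_eq_self.mpr ⟨hu.1.le, hu.2.trans_le h1⟩]
  rw [saw2, this, intervalIntegral.integral_sub (by simp) (by simp)]
  simp
  ring

theorem saw3_eq {z : ℝ} (h0 : 0 ≤ z) (h1 : z ≤ 1) :
    saw3 z = z ^ 3 / 6 - z ^ 2 / 4 + z / 12 := by
  have : saw3 z = ∫ u in (0 : ℝ)..z, (u ^ 2 / 2 - u / 2 + 1 / 12) := by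
    refine intervalIntegral.integral_congr fun u hu => ?_
    rw [uIcc_of_le h0] at hu
    exact saw2_eq hu.1 (hu.2.trans h1)
  rw [this, intervalIntegral.integral_eq_sub_of_hasDerivAt
    (f := fun z => z ^ 3 / 6 - z ^ 2 / 4 + z / 12) _
    (Continuous.intervalIntegrable (by fun_prop) _ _)]
  · simp
  · intro x _
    have := (((hasDerivAt_pow 3 x).div_const 6).sub ((hasDerivAt_pow 2 x).div_const 4)).add
      ((hasDerivAt_id x).div_const 12)
    exact this.congr_deriv (by norm_num; ring)

theorem saw4_eq {z : ℝ} (h0 : 0 ≤ z) (h1 : z ≤ 1) :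
    saw4 z = z ^ 4 / 24 - z ^ 3 / 12 + z ^ 2 / 24 := by
  have : saw4 z = ∫ u in (0 : ℝ)..z, (u ^ 3 / 6 - u ^ 2 / 4 + u / 12) := by
    refine intervalIntegral.integral_congr fun u hu => ?_
    rw [uIcc_of_le h0] at hu
    exact saw3_eq hu.1 (hu.2.trans h1)
  rw [this, intervalIntegral.integral_eq_sub_of_hasDerivAt
    (f := fun z => z ^ 4 / 24 - z ^ 3 / 12 + z ^ 2 / 24) _
    (Continuous.intervalIntegrable (by fun_prop) _ _)]
  · simp
  · intro x _
    have := (((hasDerivAt_pow 4 x).div_const 24).sub ((hasDerivAt_pow 3 x).div_const 12)).add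
      ((hasDerivAt_pow 2 x).div_const 24)
    exact this.congr_deriv (by norm_num; ring)

theorem periodic_saw2 : Function.Periodic saw2 1 := by
  have h : ∫ u in (0 : ℝ)..1, saw u = 0 := by
    have := saw2_eq zero_le_one le_rfl
    rw [saw2] at this
    linarith
  have hp : Function.Periodic saw 1 := fun u => by simp [saw]
  exact fun z => congrArg (· + 1 / 12) (periodic_primitive hp intervalIntegrable_saw h z)

theorem periodic_saw3 : Function.Periodic saw3 1 :=
  periodic_primitive periodic_saw2 (fun _ _ => continuous_saw2.intervalIntegrable _ _)
    ((saw3_eq zero_le_one le_rfl).trans (by norm_num))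

theorem periodic_saw4 : Function.Periodic saw4 1 :=
  periodic_primitive periodic_saw3 (fun _ _ => continuous_saw3.intervalIntegrable _ _)
    ((saw4_eq zero_le_one le_rfl).trans (by norm_num))

theorem exists_bound_of_periodic {φ : ℝ → ℝ} (hφ : Function.Periodic φ 1) (hc : Continuous φ) :
    ∃ C, ∀ x, |φ x| ≤ C := by
  obtain ⟨C, hC⟩ := (hφ.isBounded_of_continuous one_ne_zero hc).exists_norm_le
  exact ⟨C, fun x => hC _ (mem_range_self x)⟩

theorem hasDerivAt_saw3 (z : ℝ) : HasDerivAt saw3 (saw2 z) z :=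
  intervalIntegral.integral_hasDerivAt_right (continuous_saw2.intervalIntegrable _ _)
    (continuous_saw2.stronglyMeasurableAtFilter _ _) continuous_saw2.continuousAt

theorem hasDerivAt_saw4 (z : ℝ) : HasDerivAt saw4 (saw3 z) z :=
  intervalIntegral.integral_hasDerivAt_right (continuous_saw3.intervalIntegrable _ _)
    (continuous_saw3.stronglyMeasurableAtFilter _ _) continuous_saw3.continuousAt

theorem hasDerivAt_saw2 {z : ℝ} (hz : z ∉ range ((↑) : ℤ → ℝ)) : HasDerivAt saw2 (saw z) z := by
  have hc : ContinuousAt saw z :=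
    (continuousAt_fract fun h => hz ⟨_, h.symm⟩).sub_const _
  exact (intervalIntegral.integral_hasDerivAt_right (intervalIntegrable_saw _ _)
    measurable_saw.stronglyMeasurable.stronglyMeasurableAtFilter hc).add_const _

/-- The second primitive of `u ↦ u ({u} - 1/2)`; see `integral_mul_saw`. -/
noncomputable def sawMoment (z : ℝ) : ℝ := z * saw3 z - 2 * saw4 z

theorem continuous_sawMoment : Continuous sawMoment :=
  (continuous_id.mul continuous_saw3).sub (continuous_const.mul continuous_saw4)

theorem integral_mul_saw (z : ℝ) :
    ∫ u in (0 : ℝ)..z, (z - u) * u * saw u = sawMoment z := by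
  have h3 : saw3 0 = 0 := by simp [saw3]
  have h4 : saw4 0 = 0 := by simp [saw4]
  -- Repeated integration by parts, with primitives of `saw` and derivatives of `(z - u) u`.
  rw [MeasureTheory.integral_eq_of_hasDerivAt_off_countable
    (fun u => (z - u) * u * saw2 u - (z - 2 * u) * saw3 u - 2 * saw4 u) _
    (s := range ((↑) : ℤ → ℝ)) (countable_range _)]
  · simp [h3, h4, sawMoment]
    ring
  · have := continuous_saw2
    have := continuous_saw3
    have := continuous_saw4
    fun_prop
  · rintro u ⟨-, hu⟩
    have h1 : HasDerivAt (fun u : ℝ => (z - u) * u) (z - 2 * u) u := by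
      exact (((hasDerivAt_id u).const_sub z).mul (hasDerivAt_id u)).congr_deriv (by simp; ring)
    have h2 : HasDerivAt (fun u : ℝ => z - 2 * u) (-2) u := by
      simpa using ((hasDerivAt_id u).const_mul 2).const_sub z
    exact (((h1.mul (hasDerivAt_saw2 hu)).sub (h2.mul (hasDerivAt_saw3 u))).sub
      ((hasDerivAt_saw4 u).const_mul 2)).congr_deriv (by ring)
  · exact (intervalIntegrable_saw _ _).continuousOn_mul (by fun_prop)

theorem abs_sawMoment_le_cube {z : ℝ} (hz : 0 ≤ z) : |sawMoment z| ≤ z ^ 3 := by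
  rw [← integral_mul_saw]
  have := intervalIntegral.norm_integral_le_of_norm_le_const (a := 0) (b := z) (C := z * z * 1)
    (f := fun u => (z - u) * u * saw u) fun u hu => by
      rw [uIoc_of_le hz] at hu
      rw [norm_mul, norm_mul, Real.norm_eq_abs, Real.norm_eq_abs, Real.norm_eq_abs,
        abs_of_nonneg (sub_nonneg.mpr hu.2), abs_of_pos hu.1]
      have h1 := abs_saw_le u
      have h2 := hu.1.le
      have h3 := sub_nonneg.mpr hu.2
      gcongr
      · linarith
      · exact hu.2
      · linarith
  rw [sub_zero, abs_of_nonneg hz] at this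
  calc _ ≤ _ := this
    _ = z ^ 3 := by ring

theorem exists_abs_sawMoment_le : ∃ C, 1 ≤ C ∧ ∀ z, 1 ≤ z → |sawMoment z| ≤ C * z := by
  obtain ⟨A, hA⟩ := exists_bound_of_periodic periodic_saw3 continuous_saw3
  obtain ⟨B, hB⟩ := exists_bound_of_periodic periodic_saw4 continuous_saw4
  have hB0 : 0 ≤ B := (abs_nonneg _).trans (hB 0)
  have hA0 : 0 ≤ A := (abs_nonneg _).trans (hA 0)
  refine ⟨A + 2 * B + 1, by linarith, fun z hz => ?_⟩
  calc |sawMoment z| ≤ |z * saw3 z| + |2 * saw4 z| := abs_sub _ _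
    _ = z * |saw3 z| + 2 * |saw4 z| := by
        rw [abs_mul, abs_mul, abs_of_nonneg (by linarith : 0 ≤ z), abs_two]
    _ ≤ z * A + 2 * B := by gcongr; exacts [hA z, hB z]
    _ ≤ _ := by nlinarith

/-- The profile `s ↦ s q(1/s)`, where `q` is `sawMoment`. -/
noncomputable def sawProfile (s : ℝ) : ℝ := s * sawMoment s⁻¹

theorem continuousOn_sawProfile : ContinuousOn sawProfile (Ioi 0) := by
  refine continuousOn_id.mul (continuous_sawMoment.comp_continuousOn ?_)
  exact continuousOn_inv₀.mono fun x hx => ne_of_gt hx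

theorem exists_abs_sawProfile_le :
    ∃ C, 0 ≤ C ∧ ∀ s, 0 < s → |sawProfile s| ≤ C * min 1 (s ^ 2)⁻¹ := by
  obtain ⟨C, hC1, hC⟩ := exists_abs_sawMoment_le
  refine ⟨C, by linarith, fun s hs => ?_⟩
  rw [sawProfile, abs_mul, abs_of_pos hs, mul_min_of_nonneg _ _ (by linarith : 0 ≤ C)]
  have h2 : s * |sawMoment s⁻¹| ≤ C * (s ^ 2)⁻¹ := by
    calc s * |sawMoment s⁻¹| ≤ s * s⁻¹ ^ 3 := by
          gcongr; exact abs_sawMoment_le_cube (inv_nonneg.mpr hs.le)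
      _ = 1 * (s ^ 2)⁻¹ := by field_simp
      _ ≤ _ := by gcongr
  refine le_min ?_ h2
  rcases le_total s 1 with h | h
  · calc s * |sawMoment s⁻¹| ≤ s * (C * s⁻¹) := by
          gcongr; exact hC _ ((one_le_inv₀ hs).mpr h)
      _ = C * 1 := by field_simp
  · refine h2.trans ?_
    gcongr
    exact inv_le_one_of_one_le₀ (one_le_pow₀ h)

theorem integrableOn_min_inv_sq :
    MeasureTheory.IntegrableOn (fun s : ℝ => min 1 (s ^ 2)⁻¹) (Ioi 0) := by
  rw [← Ioc_union_Ioi_eq_Ioi (zero_le_one' ℝ)]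
  have hm : Measurable fun s : ℝ => min 1 (s ^ 2)⁻¹ := by fun_prop
  refine MeasureTheory.IntegrableOn.union ?_ ?_
  · refine MeasureTheory.Measure.integrableOn_of_bounded (M := 1)
      measure_Ioc_lt_top.ne hm.aestronglyMeasurable (.of_forall fun u => ?_)
    rw [Real.norm_eq_abs, abs_of_nonneg (by positivity)]
    exact min_le_left _ _
  · have h := integrableOn_Ioi_rpow_of_lt (show (-2 : ℝ) < -1 by norm_num) zero_lt_one
    refine MeasureTheory.Integrable.mono' h hm.aestronglyMeasurable ?_
    refine (MeasureTheory.ae_restrict_mem measurableSet_Ioi).mono fun s hs => ?_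
    have hs0 : (0 : ℝ) < s := lt_trans one_pos hs
    rw [Real.norm_eq_abs, abs_of_nonneg (by positivity), Real.rpow_neg hs0.le, Real.rpow_two]
    exact min_le_right _ _

theorem integrableOn_of_le_min {G : ℝ → ℝ} {C : ℝ} (hc : ContinuousOn G (Ioi 0))
    (hG : ∀ s, 0 < s → |G s| ≤ C * min 1 (s ^ 2)⁻¹) : MeasureTheory.IntegrableOn G (Ioi 0) :=
  MeasureTheory.Integrable.mono' (integrableOn_min_inv_sq.const_mul C)
    (hc.aestronglyMeasurable measurableSet_Ioi)
    ((MeasureTheory.ae_restrict_mem measurableSet_Ioi).mono fun s hs => hG s hs)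

theorem integral_sawProfile : ∫ s in Ioi (0 : ℝ), sawProfile s = -1 / 24 := by
  obtain ⟨C, -, hC⟩ := exists_abs_sawProfile_le
  obtain ⟨B, hB⟩ := exists_bound_of_periodic periodic_saw4 continuous_saw4
  -- A primitive is `s ↦ -s² saw4(1/s)`, and `saw4 z = z²/24 + O(z³)` at `z = 0`.
  have h := MeasureTheory.integral_Ioi_of_hasDerivAt_of_tendsto (a := 0)
    (f := fun s => -(s ^ 2 * saw4 s⁻¹)) (f' := sawProfile) (m := -(1 / 24)) ?_ ?_
    (integrableOn_of_le_min continuousOn_sawProfile hC) ?_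
  · rw [h]; norm_num
  · refine Tendsto.mono_left ?_ nhdsWithin_le_nhds
    have hlim : Tendsto (fun s : ℝ => s ^ 2 * saw4 s⁻¹) (𝓝 0) (𝓝 0) := by
      refine squeeze_zero_norm (a := fun s : ℝ => s ^ 2 * B) (fun s => ?_) ?_
      · rw [norm_mul, Real.norm_of_nonneg (sq_nonneg s)]
        gcongr
        exact hB _
      · have : Continuous fun s : ℝ => s ^ 2 * B := by fun_prop
        simpa using this.tendsto 0
    simpa using hlim.neg
  · intro s hs
    have hs0 : s ≠ 0 := ne_of_gt hs
    have h1 := (hasDerivAt_pow 2 s).mul ((hasDerivAt_saw4 s⁻¹).comp s (hasDerivAt_inv hs0))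
    refine h1.neg.congr_deriv ?_
    simp only [sawProfile, sawMoment, Function.comp]
    push_cast
    field_simp
    ring
  · have hlim : Tendsto (fun s : ℝ => -(s⁻¹ ^ 2 / 24 - s⁻¹ / 12 + 1 / 24)) atTop
        (𝓝 (-(0 ^ 2 / 24 - 0 / 12 + 1 / 24))) :=
      ((((tendsto_inv_atTop_zero.pow 2).div_const 24).sub
        (tendsto_inv_atTop_zero.div_const 12)).add_const _).neg
    rw [show -((0 : ℝ) ^ 2 / 24 - 0 / 12 + 1 / 24) = -(1 / 24) by norm_num] at hlim
    refine hlim.congr' ?_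
    filter_upwards [eventually_ge_atTop 1] with s hs
    have hs0 : 0 < s := by linarith
    rw [saw4_eq (inv_nonneg.mpr hs0.le) (inv_le_one_of_one_le₀ hs)]
    field_simp

/-! ### Riemann sums and mean values of arithmetic functions -/

theorem hasSum_integral_natCeil {F : ℕ → ℝ}
    (hF : MeasureTheory.IntegrableOn (fun u : ℝ => F ⌈u⌉₊) (Ioi 0)) :
    HasSum (fun e : ℕ => F (e + 1)) (∫ u in Ioi (0 : ℝ), F ⌈u⌉₊) := by
  have hmono : Monotone fun n : ℕ => (n : ℝ) := Nat.mono_cast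
  have hU : ⋃ n : ℕ, Ioc (n : ℝ) ((n + 1 : ℕ) : ℝ) = Ioi 0 := by
    simpa using iUnion_Ioc_map_succ_eq_Ioi (fun n => hmono (Nat.zero_le n))
      (not_bddAbove_iff.mpr fun x => by
        obtain ⟨n, hn⟩ := exists_nat_gt x
        exact ⟨n, mem_range_self n, hn⟩)
  rw [← hU] at hF ⊢
  have h := MeasureTheory.hasSum_integral_iUnion (fun n : ℕ => measurableSet_Ioc)
    hmono.pairwise_disjoint_on_Ioc_succ hF
  refine Eq.mp (congrArg (HasSum · _) (funext fun n => ?_)) h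
  have : ∫ u in Ioc (n : ℝ) ((n + 1 : ℕ) : ℝ), F ⌈u⌉₊ =
      ∫ u in Ioc (n : ℝ) ((n + 1 : ℕ) : ℝ), F (n + 1) := by
    refine MeasureTheory.setIntegral_congr_fun measurableSet_Ioc fun u hu => ?_
    have : ⌈u⌉₊ = n + 1 := by
      rw [Nat.ceil_eq_iff (by omega)]
      simpa using hu
    simp only [this]
  exact this.trans (by simp)

/-- The Riemann sum of `G` on `(0, ∞)` with mesh `1 / x`, evaluated at right endpoints. -/
noncomputable def riemannSum (G : ℝ → ℝ) (x : ℝ) : ℝ := (∑' e : ℕ+, G (e / x)) / x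

section

variable {G : ℝ → ℝ} {C : ℝ}

/-- Rounding up to the grid only moves the argument to the right, so the decreasing majorant
survives the rounding. -/
theorem abs_natCeil_div_le (hC : 0 ≤ C) (hG : ∀ s, 0 < s → |G s| ≤ C * min 1 (s ^ 2)⁻¹)
    {x s : ℝ} (hx : 0 < x) (hs : 0 < s) : |G (⌈x * s⌉₊ / x)| ≤ C * min 1 (s ^ 2)⁻¹ := by
  have hle : s ≤ ⌈x * s⌉₊ / x := by
    rw [le_div_iff₀ hx, mul_comm]
    exact Nat.le_ceil _
  refine (hG _ (hs.trans_le hle)).trans ?_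
  gcongr

theorem integrableOn_natCeil_div (hC : 0 ≤ C)
    (hG : ∀ s, 0 < s → |G s| ≤ C * min 1 (s ^ 2)⁻¹) {x : ℝ} (hx : 0 < x) :
    MeasureTheory.IntegrableOn (fun s : ℝ => G (⌈x * s⌉₊ / x)) (Ioi 0) := by
  refine MeasureTheory.Integrable.mono' (integrableOn_min_inv_sq.const_mul C) ?_
    ((MeasureTheory.ae_restrict_mem measurableSet_Ioi).mono
      fun s hs => abs_natCeil_div_le hC hG hx hs)
  have h : Measurable fun n : ℕ => G (n / x) := measurable_from_nat
  exact (h.comp (Nat.measurable_ceil.comp (measurable_const_mul x))).aestronglyMeasurable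

theorem riemannSum_eq_integral (hC : 0 ≤ C)
    (hG : ∀ s, 0 < s → |G s| ≤ C * min 1 (s ^ 2)⁻¹) {x : ℝ} (hx : 0 < x) :
    riemannSum G x = ∫ s in Ioi (0 : ℝ), G (⌈x * s⌉₊ / x) := by
  have hi := integrableOn_natCeil_div hC hG hx
  have hi' : MeasureTheory.IntegrableOn (fun u : ℝ => G (⌈u⌉₊ / x)) (Ioi 0) := by
    have := (MeasureTheory.integrableOn_Ioi_comp_mul_left_iff
      (fun u : ℝ => G (⌈u⌉₊ / x)) 0 hx).mp hi
    simpa using this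
  have h := (hasSum_integral_natCeil (F := fun n => G (n / x)) hi').tsum_eq
  have h2 := MeasureTheory.integral_comp_mul_left_Ioi (fun u : ℝ => G (⌈u⌉₊ / x)) 0 hx
  rw [riemannSum, tsum_pnat_eq_tsum_succ (f := fun n : ℕ => G (n / x)), h, h2, mul_zero,
    smul_eq_mul, inv_mul_eq_div]

theorem abs_riemannSum_le (hC : 0 ≤ C)
    (hG : ∀ s, 0 < s → |G s| ≤ C * min 1 (s ^ 2)⁻¹) {x : ℝ} (hx : 0 < x) :
    |riemannSum G x| ≤ ∫ s in Ioi (0 : ℝ), C * min 1 (s ^ 2)⁻¹ := by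
  rw [riemannSum_eq_integral hC hG hx, ← Real.norm_eq_abs]
  exact MeasureTheory.norm_integral_le_of_norm_le (integrableOn_min_inv_sq.const_mul C)
    ((MeasureTheory.ae_restrict_mem measurableSet_Ioi).mono
      fun s hs => abs_natCeil_div_le hC hG hx hs)

theorem tendsto_riemannSum (hC : 0 ≤ C) (hc : ContinuousOn G (Ioi 0))
    (hG : ∀ s, 0 < s → |G s| ≤ C * min 1 (s ^ 2)⁻¹) :
    Tendsto (riemannSum G) atTop (𝓝 (∫ s in Ioi (0 : ℝ), G s)) := by
  have key : Tendsto (fun x : ℝ => ∫ s in Ioi (0 : ℝ), G (⌈x * s⌉₊ / x)) atTop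
      (𝓝 (∫ s in Ioi (0 : ℝ), G s)) := by
    refine MeasureTheory.tendsto_integral_filter_of_dominated_convergence
      (fun s => C * min 1 (s ^ 2)⁻¹) ?_ ?_ (integrableOn_min_inv_sq.const_mul C) ?_
    · filter_upwards [eventually_gt_atTop 0] with x hx
      exact (integrableOn_natCeil_div hC hG hx).aestronglyMeasurable
    · filter_upwards [eventually_gt_atTop 0] with x hx
      exact (MeasureTheory.ae_restrict_mem measurableSet_Ioi).mono
        fun s hs => abs_natCeil_div_le hC hG hx hs
    · refine (MeasureTheory.ae_restrict_mem measurableSet_Ioi).mono fun s hs => ?_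
      have h1 : Tendsto (fun x : ℝ => (⌈x * s⌉₊ : ℝ) / x) atTop (𝓝 s) := by
        simpa only [mul_comm] using tendsto_nat_ceil_mul_div_atTop (mem_Ioi.mp hs).le
      exact ((hc.continuousAt (Ioi_mem_nhds hs)).tendsto).comp h1
  refine key.congr' ?_
  filter_upwards [eventually_gt_atTop 0] with x hx
  exact (riemannSum_eq_integral hC hG hx).symm

theorem summable_pnat_mul (hC : 0 ≤ C) (hG : ∀ s, 0 < s → |G s| ≤ C * min 1 (s ^ 2)⁻¹)
    {g : ℕ → ℝ} (hg : Summable fun n : ℕ => |g n / n|) {x : ℝ} (hx : 0 < x) :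
    Summable fun p : ℕ+ × ℕ+ => g p.1 * G ((p.1 * p.2 : ℕ) / x) := by
  have h1 : Summable fun n : ℕ+ => |g n / n| := hg.comp_injective PNat.coe_injective
  have h2 : Summable fun e : ℕ+ => 1 / ((e : ℕ) : ℝ) ^ 2 :=
    (Real.summable_one_div_nat_pow.mpr one_lt_two).comp_injective PNat.coe_injective
  refine Summable.of_norm_bounded (((h1.mul_of_nonneg h2 (fun _ => abs_nonneg _)
    (fun _ => by positivity))).mul_left (C * x ^ 2)) ?_
  rintro ⟨n, e⟩
  have hn : (1 : ℝ) ≤ (n : ℕ) := by exact_mod_cast n.2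
  have he : (0 : ℝ) < (e : ℕ) := by exact_mod_cast e.2
  have hb := (hG (((n * e : ℕ) : ℝ) / x) (by push_cast; positivity)).trans
    (mul_le_mul_of_nonneg_left (min_le_right _ _) hC)
  rw [norm_mul, Real.norm_eq_abs, Real.norm_eq_abs, abs_div, abs_of_pos (by linarith : (0:ℝ) < n)]
  calc |g n| * |G (((n * e : ℕ) : ℝ) / x)| ≤ |g n| * (C * ((((n * e : ℕ) : ℝ) / x) ^ 2)⁻¹) := by
        gcongr
    _ = C * x ^ 2 * (|g n| / (n * n) * (1 / (e : ℝ) ^ 2)) := by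
        push_cast
        field_simp
    _ ≤ C * x ^ 2 * (|g n| / n * (1 / (e : ℝ) ^ 2)) := by
        gcongr
        nlinarith

/-- If `a n = ∑_{d ∣ n} g d` with `∑ g n / n` absolutely convergent, then `a` has mean value
`∑ g n / n`, in the sense that weighted averages of `a` are averages of Riemann sums. -/
theorem hasSum_divisors_mul (hC : 0 ≤ C) (hG : ∀ s, 0 < s → |G s| ≤ C * min 1 (s ^ 2)⁻¹)
    {g : ℕ → ℝ} (hg : Summable fun n : ℕ => |g n / n|) {x : ℝ} (hx : 0 < x) :
    HasSum (fun d : ℕ+ => (∑ n ∈ (d : ℕ).divisors, g n) * G (d / x))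
      (x * ∑' n : ℕ+, g n / n * riemannSum G (x / n)) := by
  have hs := summable_pnat_mul hC hG hg hx
  have h1 := (sigmaAntidiagonalEquivProd.hasSum_iff.mpr hs.hasSum).sigma
    (g := fun d : ℕ+ => (∑ n ∈ (d : ℕ).divisors, g n) * G (d / x)) fun d => by
      have := hasSum_fintype (fun p : Nat.divisorsAntidiagonal d =>
        g p.1.1 * G ((p.1.1 * p.1.2 : ℕ) / x))
      refine Eq.mp (congrArg (HasSum (fun p : Nat.divisorsAntidiagonal d =>
        g p.1.1 * G ((p.1.1 * p.1.2 : ℕ) / x))) ?_) this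
      rw [Finset.sum_coe_sort (Nat.divisorsAntidiagonal d)
        (fun p => g p.1 * G ((p.1 * p.2 : ℕ) / x)), Finset.sum_mul,
        ← Nat.sum_divisorsAntidiagonal (fun n _ => g n * G ((d : ℕ) / x))]
      refine Finset.sum_congr rfl fun p hp => ?_
      rw [(Nat.mem_divisorsAntidiagonal.mp hp).1]
  convert h1 using 1
  rw [hs.tsum_prod, ← tsum_mul_left]
  refine tsum_congr fun n => ?_
  have hn : (0 : ℝ) < (n : ℕ) := by exact_mod_cast n.2
  have h2 : ∀ e : ℕ+, ((n * e : ℕ) : ℝ) / x = e / (x / n) := fun e => by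
    push_cast
    field_simp
  simp only [h2, tsum_mul_left, riemannSum]
  field_simp

theorem abs_tsum_riemannSum_le (hC : 0 ≤ C) (hG : ∀ s, 0 < s → |G s| ≤ C * min 1 (s ^ 2)⁻¹)
    {g : ℕ → ℝ} (hg : Summable fun n : ℕ => |g n / n|) {x : ℝ} (hx : 0 < x) :
    |∑' n : ℕ+, g n / n * riemannSum G (x / n)| ≤
      (∑' n : ℕ+, |g n / n|) * ∫ s in Ioi (0 : ℝ), C * min 1 (s ^ 2)⁻¹ := by
  have h1 : Summable fun n : ℕ+ => |g n / n| := hg.comp_injective PNat.coe_injective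
  rw [← tsum_mul_right, ← Real.norm_eq_abs]
  refine tsum_of_norm_bounded (h1.mul_right _).hasSum fun n => ?_
  have hn : (0 : ℝ) < (n : ℕ) := by exact_mod_cast n.2
  rw [norm_mul, Real.norm_eq_abs]
  gcongr
  exact abs_riemannSum_le hC hG (by positivity)

theorem tendsto_tsum_riemannSum (hC : 0 ≤ C) (hc : ContinuousOn G (Ioi 0))
    (hG : ∀ s, 0 < s → |G s| ≤ C * min 1 (s ^ 2)⁻¹)
    {g : ℕ → ℝ} (hg : Summable fun n : ℕ => |g n / n|) :
    Tendsto (fun x => ∑' n : ℕ+, g n / n * riemannSum G (x / n)) atTop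
      (𝓝 ((∑' n : ℕ+, g n / n) * ∫ s in Ioi (0 : ℝ), G s)) := by
  have h1 : Summable fun n : ℕ+ => |g n / n| := hg.comp_injective PNat.coe_injective
  rw [← tsum_mul_right]
  refine tendsto_tsum_of_dominated_convergence
    (h1.mul_right (∫ s in Ioi (0 : ℝ), C * min 1 (s ^ 2)⁻¹)) (fun n => ?_) ?_
  · have hn : (0 : ℝ) < (n : ℕ) := by exact_mod_cast n.2
    exact ((tendsto_riemannSum hC hc hG).comp (tendsto_id.atTop_div_const hn)).const_mul _
  · filter_upwards [eventually_gt_atTop 0] with x hx n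
    have hn : (0 : ℝ) < (n : ℕ) := by exact_mod_cast n.2
    rw [norm_mul, Real.norm_eq_abs]
    gcongr
    exact abs_riemannSum_le hC hG (by positivity)

end

/-! ### The error term in the summatory function of `ν` -/

/-- The error term `∑_{r ≤ w} ν r - H₁ w + H₀ / 2` of the summatory function of `ν`, where
`H₀ = ∑ nuMob d` and `H₁ = ∑ nuMob d / d`. -/
noncomputable def nuError (w : ℝ) : ℝ :=
  ∑ r ∈ Finset.Icc 1 ⌊w⌋₊, ν r - (∑' d : ℕ, nuMob d / d) * w + (∑' d, nuMob d) / 2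

open ArithmeticFunction in
theorem sum_nu_eq (N : ℕ) : ∑ r ∈ Finset.Icc 1 N, ν r =
    ∑ d ∈ Finset.Icc 1 N, nuMob d * ((N / d : ℕ) : ℝ) := by
  have h := sum_Ioc_mul_zeta_eq_sum nuMob N
  rw [mul_comm, nuMob, zeta_mul_moebius_mul] at h
  refine Eq.trans ?_ h
  refine Finset.sum_congr rfl fun r hr => ?_
  rw [nuArith_apply (by have := (Finset.mem_Icc.mp hr).1; omega)]

theorem hasSum_nuError {w : ℝ} (hw : 0 ≤ w) :
    HasSum (fun d : ℕ => -(nuMob d * saw (w / d))) (nuError w) := by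
  have h1 : HasSum (fun d : ℕ => nuMob d * (⌊w / d⌋₊ : ℝ)) (∑ r ∈ Finset.Icc 1 ⌊w⌋₊, ν r) := by
    have : ∑ r ∈ Finset.Icc 1 ⌊w⌋₊, ν r =
        ∑ d ∈ Finset.Icc 1 ⌊w⌋₊, nuMob d * (⌊w / d⌋₊ : ℝ) := by
      rw [sum_nu_eq]
      simp only [Nat.floor_div_natCast]
    rw [this]
    refine hasSum_sum_of_ne_finset_zero fun d hd => ?_
    rcases Nat.eq_zero_or_pos d with rfl | hd0
    · simp
    · have : w < d := by
        rw [← Nat.floor_lt hw]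
        by_contra hcon
        exact hd (Finset.mem_Icc.mpr ⟨hd0, not_lt.mp hcon⟩)
      have hd0' : (0 : ℝ) < d := by exact_mod_cast hd0
      rw [Nat.floor_eq_zero.mpr ((div_lt_one hd0').mpr this)]
      simp
  have h2 := summable_nuMob_div.hasSum.mul_right w
  have h3 := (summable_nuMob.of_abs).hasSum.div_const 2
  refine Eq.mp (congrArg (HasSum · _) (funext fun d => ?_)) ((h1.sub h2).add h3)
  have h4 : (⌊w / d⌋₊ : ℝ) = w / d - Int.fract (w / d) := by
    rw [natCast_floor_eq_intCast_floor (by positivity)]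
    exact (Int.self_sub_fract _).symm
  rw [h4, saw]
  ring

theorem abs_nuError_le {w : ℝ} (hw : 0 ≤ w) : |nuError w| ≤ ∑' d, |nuMob d| := by
  rw [← (hasSum_nuError hw).tsum_eq, ← Real.norm_eq_abs]
  refine tsum_of_norm_bounded summable_nuMob.hasSum fun d => ?_
  rw [norm_neg, norm_mul, Real.norm_eq_abs, Real.norm_eq_abs]
  exact mul_le_of_le_one_right (abs_nonneg _) ((abs_saw_le _).trans (by norm_num))

theorem measurable_nuError : Measurable nuError := by
  have h : Measurable fun n : ℕ => ∑ r ∈ Finset.Icc 1 n, ν r := measurable_from_nat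
  exact ((h.comp Nat.measurable_floor).sub (measurable_const_mul _)).add_const _

/-- The second primitive of `w ↦ w * nuError w`. -/
noncomputable def nuErrorMoment (x : ℝ) : ℝ := ∫ w in (0 : ℝ)..x, (x - w) * w * nuError w

theorem integral_mul_saw_div (x : ℝ) {d : ℝ} (hd : 0 < d) :
    ∫ w in (0 : ℝ)..x, (x - w) * w * saw (w / d) = d ^ 3 * sawMoment (x / d) := by
  have h := intervalIntegral.integral_comp_div (a := 0) (b := x)
    (fun u => d ^ 2 * ((x / d - u) * u * saw u)) hd.ne'
  rw [intervalIntegral.integral_const_mul (μ := MeasureTheory.volume) (a := 0 / d), zero_div,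
    integral_mul_saw, smul_eq_mul] at h
  rw [pow_succ', mul_assoc, ← h]
  refine intervalIntegral.integral_congr fun w _ => ?_
  field_simp

theorem hasSum_nuErrorMoment {x : ℝ} (hx : 0 < x) :
    HasSum (fun d : ℕ => -(nuMob d * ((d : ℝ) ^ 3 * sawMoment (x / d)))) (nuErrorMoment x) := by
  have h := intervalIntegral.hasSum_integral_of_dominated_convergence
    (μ := MeasureTheory.volume) (a := 0) (b := x)
    (F := fun (d : ℕ) w => (x - w) * w * -(nuMob d * saw (w / d)))
    (f := fun w => (x - w) * w * nuError w)
    (fun d _ => x * x * |nuMob d|) (fun d => ?_) (fun d => .of_forall fun w hw => ?_)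
    (.of_forall fun w _ => summable_nuMob.mul_left _) intervalIntegrable_const
    (.of_forall fun w hw => ?_)
  · refine Eq.mp (congrArg (HasSum · _) (funext fun d => ?_)) h
    rcases Nat.eq_zero_or_pos d with rfl | hd
    · simp
    · rw [← integral_mul_saw_div x (by exact_mod_cast hd : (0 : ℝ) < d),
        ← intervalIntegral.integral_const_mul, ← intervalIntegral.integral_neg]
      exact intervalIntegral.integral_congr fun w _ => by ring
  · have : Measurable fun w : ℝ => saw (w / d) := measurable_saw.comp (measurable_id.div_const _)
    exact Measurable.aestronglyMeasurable (by fun_prop)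
  · rw [uIoc_of_le hx.le] at hw
    simp only [norm_mul, norm_neg, Real.norm_eq_abs]
    rw [abs_of_nonneg (sub_nonneg.mpr hw.2), abs_of_pos hw.1]
    have h1 : |nuMob d| * |saw (w / d)| ≤ |nuMob d| :=
      mul_le_of_le_one_right (abs_nonneg _) ((abs_saw_le _).trans (by norm_num))
    have h2 := sub_nonneg.mpr hw.2
    have h3 := hw.1.le
    gcongr
    · linarith
    · exact hw.2
  · rw [uIoc_of_le hx.le] at hw
    exact (hasSum_nuError hw.1.le).mul_left _

/-- With `q = sawMoment` and `G = sawProfile`, the terms of the series `∑ d³ nuMob d q(x/d)` are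
`x · d² nuMob d · G(d/x)`, so that the mean value of `d² nuMob d` governs its size. -/
theorem nuErrorMoment_div_sq {x : ℝ} (hx : 0 < x) : nuErrorMoment x / x ^ 2 =
    -∑' n : ℕ+, sqNuMobMob n / n * riemannSum sawProfile (x / n) := by
  obtain ⟨C, hC, hG⟩ := exists_abs_sawProfile_le
  have h1 := hasSum_divisors_mul hC hG summable_and_hasProd_sqNuMobMob_div.1 hx
  have h2 : HasSum (fun d : ℕ+ => -(nuMob d * ((d : ℝ) ^ 3 * sawMoment (x / d))))
      (nuErrorMoment x) :=
    (PNat.coe_injective.hasSum_iff (f := fun d : ℕ =>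
      -(nuMob d * ((d : ℝ) ^ 3 * sawMoment (x / d)))) fun d hd => by
        have : d = 0 := by
          by_contra h0
          exact hd ⟨⟨d, Nat.pos_of_ne_zero h0⟩, rfl⟩
        simp [this]).mpr (hasSum_nuErrorMoment hx)
  have h3 : HasSum (fun d : ℕ+ => -(nuMob d * ((d : ℝ) ^ 3 * sawMoment (x / d))))
      (-(x * (x * ∑' n : ℕ+, sqNuMobMob n / n * riemannSum sawProfile (x / n)))) := by
    refine Eq.mp (congrArg (HasSum · _) (funext fun d => ?_)) (h1.mul_left x).neg
    rw [sum_divisors_sqNuMobMob, sqNuMob_apply, sawProfile, inv_div]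
    field_simp
  rw [h2.unique h3]
  field_simp

theorem exists_abs_nuErrorMoment_div_sq_le : ∃ B, ∀ x, 0 < x → |nuErrorMoment x / x ^ 2| ≤ B := by
  obtain ⟨C, hC, hG⟩ := exists_abs_sawProfile_le
  refine ⟨(∑' n : ℕ+, |sqNuMobMob n / n|) * ∫ s in Ioi (0 : ℝ), C * min 1 (s ^ 2)⁻¹,
    fun x hx => ?_⟩
  rw [nuErrorMoment_div_sq hx, abs_neg]
  exact abs_tsum_riemannSum_le hC hG summable_and_hasProd_sqNuMobMob_div.1 hx

theorem tendsto_nuErrorMoment_div_sq : Tendsto (fun x => nuErrorMoment x / x ^ 2) atTop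
    (𝓝 ((∑' n : ℕ, sqNuMobMob n / n) / 24)) := by
  obtain ⟨C, hC, hG⟩ := exists_abs_sawProfile_le
  have h := (tendsto_tsum_riemannSum hC continuousOn_sawProfile hG
    summable_and_hasProd_sqNuMobMob_div.1).neg
  have e : ∑' n : ℕ+, sqNuMobMob n / n = ∑' n : ℕ, sqNuMobMob n / n :=
    PNat.coe_injective.tsum_eq (f := fun n : ℕ => sqNuMobMob n / n) fun n hn => by
      refine ⟨⟨n, Nat.pos_of_ne_zero ?_⟩, rfl⟩
      rintro rfl
      simp at hn
  rw [e, integral_sawProfile] at h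
  have h' := h.congr' (f₂ := fun x => nuErrorMoment x / x ^ 2) (by
    filter_upwards [eventually_gt_atTop 0] with x hx
    exact (nuErrorMoment_div_sq hx).symm)
  convert h' using 2
  ring

/-! ### Trigonometric integrals -/

theorem sin_odd_mul_pi_div_two (m : ℕ) :
    Real.sin ((2 * m + 1) * (Real.pi / 2)) = (-1) ^ m := by
  rw [show ((2 * m + 1) * (Real.pi / 2) : ℝ) = Real.pi / 2 + m * Real.pi by ring,
    Real.sin_add_nat_mul_pi, Real.sin_pi_div_two, mul_one]

theorem integral_cos_mul {a : ℝ} (ha : a ≠ 0) (b : ℝ) :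
    ∫ t in (0 : ℝ)..b, Real.cos (a * t) = Real.sin (a * b) / a := by
  rw [intervalIntegral.integral_comp_mul_left (fun t => Real.cos t) ha, integral_cos]
  simp [inv_mul_eq_div]

theorem integral_cos_even_mul (j : ℕ) :
    ∫ t in (0 : ℝ)..Real.pi / 2, Real.cos ((2 * j + 2) * t) = 0 := by
  rw [integral_cos_mul (by positivity),
    show ((2 * j + 2) * (Real.pi / 2) : ℝ) = ((j + 1 : ℕ) : ℝ) * Real.pi by push_cast; ring,
    Real.sin_nat_mul_pi, zero_div]

theorem integral_cos_odd_mul (m : ℕ) :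
    ∫ t in (0 : ℝ)..Real.pi / 2, Real.cos ((2 * m + 1) * t) = (-1) ^ m / (2 * m + 1) := by
  rw [integral_cos_mul (by positivity), sin_odd_mul_pi_div_two]

theorem integral_cos_odd_mul_mul_cos (m : ℕ) :
    ∫ t in (0 : ℝ)..Real.pi / 2, Real.cos ((2 * m + 1) * t) * Real.cos t =
      if m = 0 then Real.pi / 4 else 0 := by
  rcases m with _ | j
  · have := integral_cos_sq (a := 0) (b := Real.pi / 2)
    simp only [sq] at this
    simp [this]
    ring
  · have h : ∀ t : ℝ, Real.cos ((2 * (j + 1 : ℕ) + 1) * t) * Real.cos t =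
        (Real.cos ((2 * (j + 1 : ℕ) + 2) * t) + Real.cos ((2 * j + 2) * t)) / 2 := fun t => by
      rw [show ((2 * (j + 1 : ℕ) + 2) * t : ℝ) = (2 * (j + 1 : ℕ) + 1) * t + t by ring,
        show ((2 * j + 2) * t : ℝ) = (2 * (j + 1 : ℕ) + 1) * t - t by push_cast; ring,
        Real.cos_add, Real.cos_sub]
      ring
    simp only [h]
    rw [intervalIntegral.integral_div, intervalIntegral.integral_add
      (Continuous.intervalIntegrable (by fun_prop) _ _)
      (Continuous.intervalIntegrable (by fun_prop) _ _), integral_cos_even_mul,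
      integral_cos_even_mul]
    simp

/-- The quotient `cos ((2m + 1) t) / cos t`, extended continuously to all real `t` by means of the
recursion `cos ((2m + 3) t) + cos ((2m + 1) t) = 2 cos ((2m + 2) t) cos t`. -/
noncomputable def cosQuot : ℕ → ℝ → ℝ
  | 0, _ => 1
  | m + 1, t => 2 * Real.cos ((2 * m + 2) * t) - cosQuot m t

theorem continuous_cosQuot (m : ℕ) : Continuous (cosQuot m) := by
  induction m with
  | zero => exact continuous_const
  | succ m ih => exact Continuous.sub (by fun_prop) ih

theorem cos_mul_cosQuot (m : ℕ) (t : ℝ) :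
    Real.cos t * cosQuot m t = Real.cos ((2 * m + 1) * t) := by
  induction m with
  | zero => simp [cosQuot]
  | succ m ih =>
    rw [cosQuot, mul_sub, ih, show ((2 * m + 1) * t : ℝ) = (2 * m + 2) * t - t by ring,
      show ((2 * (m + 1 : ℕ) + 1) * t : ℝ) = (2 * m + 2) * t + t by push_cast; ring,
      Real.cos_add, Real.cos_sub]
    ring

theorem integral_cosQuot (m : ℕ) :
    ∫ t in (0 : ℝ)..Real.pi / 2, cosQuot m t = (-1) ^ m * (Real.pi / 2) := by
  induction m with
  | zero => simp [cosQuot]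
  | succ m ih =>
    simp only [cosQuot]
    rw [intervalIntegral.integral_sub (Continuous.intervalIntegrable (by fun_prop) _ _)
      ((continuous_cosQuot m).intervalIntegrable _ _), intervalIntegral.integral_const_mul,
      integral_cos_even_mul, ih]
    ring

/-! ### The density as an average of the error term -/

/-- A Chebyshev summand is a truncated integral of `cos ((2m + 1) t)`. -/
theorem sqrt_mul_chebyshev_eq (m : ℕ) {r X : ℝ} (hr : 0 ≤ r) (hX : 0 < X) (hrX : r ≤ X) :
    √(X ^ 2 - r ^ 2) * (Polynomial.Chebyshev.U ℝ (2 * m : ℤ)).eval (r / X) =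
      (2 * m + 1) * X * ∫ t in (0 : ℝ)..Real.pi / 2,
        if r ≤ X * Real.cos t then Real.cos ((2 * m + 1) * t) else 0 := by
  have h0 : 0 ≤ r / X := by positivity
  have h1 : r / X ≤ 1 := (div_le_one hX).mpr hrX
  have hmem : Real.arccos (r / X) ∈ Icc 0 (Real.pi / 2) :=
    ⟨Real.arccos_nonneg _, Real.arccos_le_pi_div_two.mpr h0⟩
  have hcos : Real.cos (Real.arccos (r / X)) = r / X := Real.cos_arccos (by linarith) h1
  have hint : ∫ t in (0 : ℝ)..Real.pi / 2,
      (if r ≤ X * Real.cos t then Real.cos ((2 * m + 1) * t) else 0) =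
      ∫ t in (0 : ℝ)..Real.pi / 2, indicator {t | t ≤ Real.arccos (r / X)}
        (fun t => Real.cos ((2 * m + 1) * t)) t := by
    refine intervalIntegral.integral_congr fun t ht => ?_
    rw [uIcc_of_le (by positivity)] at ht
    have hiff : r ≤ X * Real.cos t ↔ t ≤ Real.arccos (r / X) := by
      rw [← div_le_iff₀' hX]
      nth_rewrite 1 [← hcos]
      exact Real.strictAntiOn_cos.le_iff_ge
        ⟨hmem.1, hmem.2.trans (by linarith [Real.pi_pos])⟩
        ⟨ht.1, ht.2.trans (by linarith [Real.pi_pos])⟩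
    simp only [indicator_apply, mem_ofPred_eq, hiff]
  have hs : √(X ^ 2 - r ^ 2) = X * Real.sin (Real.arccos (r / X)) := by
    rw [Real.sin_arccos, show X ^ 2 - r ^ 2 = X ^ 2 * (1 - (r / X) ^ 2) by field_simp,
      Real.sqrt_mul (sq_nonneg X), Real.sqrt_sq hX.le]
  have hU := Polynomial.Chebyshev.U_real_cos (Real.arccos (r / X)) (2 * m : ℤ)
  rw [hcos] at hU
  push_cast at hU
  rw [hint, intervalIntegral.integral_indicator hmem, integral_cos_mul (by positivity), hs,
    mul_assoc, mul_comm (Real.sin _), hU]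
  field_simp

/-- The density of weight `2m + 2` in the variable `X = 2 √y`. Negative `X` gives the even
extension, so that the function is continuous on all of `ℝ`. -/
noncomputable def scaledDensity (m : ℕ) (X : ℝ) : ℝ := density (2 * m + 2) (X ^ 2 / 4)

theorem scaledDensity_eq (m : ℕ) {X : ℝ} (hX : 0 ≤ X) : scaledDensity m X =
    α * (-1) ^ m / (2 * m + 1) * ∑ r ∈ Finset.Icc 1 ⌊X⌋₊,
      ν r * (√(X ^ 2 - (r : ℝ) ^ 2) * (Polynomial.Chebyshev.U ℝ (2 * m : ℤ)).eval (r / X))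
      + β / (2 * m + 1) * (X / 2) - (if m = 0 then γ else 0) * (X ^ 2 / 4) := by
  have h1 : √(X ^ 2 / 4) = X / 2 := by
    rw [show X ^ 2 / 4 = (X / 2) ^ 2 by ring, Real.sqrt_sq (by positivity)]
  have h2 : (2 * m + 2) / 2 - 1 = m := by omega
  have h3 : (((2 * m + 2 : ℕ) : ℤ) - 2) = 2 * m := by push_cast; ring
  have h4 : (((2 * m + 2 : ℕ) : ℝ) - 1) = 2 * m + 1 := by push_cast; ring
  have h5 : (2 * m + 2 = 2) ↔ m = 0 := by omega
  have h6 : 2 * (X / 2) = X := by ring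
  have h7 : 4 * (X ^ 2 / 4) = X ^ 2 := by ring
  simp only [scaledDensity, density, h1, h2, h3, h4, h5, h6, h7, mul_assoc, mul_ite, mul_one,
    mul_zero]

theorem measurable_nuError_mul_cos (X : ℝ) : Measurable fun t => nuError (X * Real.cos t) :=
  measurable_nuError.comp (by fun_prop)

theorem intervalIntegrable_cos_mul_nuError (m : ℕ) {X : ℝ} (hX : 0 ≤ X) :
    IntervalIntegrable (fun t => Real.cos ((2 * m + 1) * t) * nuError (X * Real.cos t))
      MeasureTheory.volume 0 (Real.pi / 2) := by
  rw [intervalIntegrable_iff, uIoc_of_le (by positivity)]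
  refine MeasureTheory.IntegrableOn.of_bound measure_Ioc_lt_top
    (Measurable.aestronglyMeasurable
      (Measurable.mul (by fun_prop) (measurable_nuError_mul_cos X))) (∑' d, |nuMob d|) ?_
  refine (MeasureTheory.ae_restrict_mem measurableSet_Ioc).mono fun t ht => ?_
  have hc : 0 ≤ Real.cos t := Real.cos_nonneg_of_mem_Icc ⟨by linarith [ht.1, Real.pi_pos], ht.2⟩
  rw [norm_mul, Real.norm_eq_abs, Real.norm_eq_abs]
  calc |Real.cos ((2 * m + 1) * t)| * |nuError (X * Real.cos t)|
      ≤ 1 * |nuError (X * Real.cos t)| := by gcongr; exact Real.abs_cos_le_one _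
    _ ≤ _ := by rw [one_mul]; exact abs_nuError_le (by positivity)

/-- The relations between `α`, `β` and `γ` say that the main terms of the summatory function of
`ν` cancel the last two terms of the density, leaving only the error term. -/
theorem scaledDensity_eq_integral (m : ℕ) {X : ℝ} (hX : 0 ≤ X) : scaledDensity m X =
    α * (-1) ^ m * X * ∫ t in (0 : ℝ)..Real.pi / 2,
      Real.cos ((2 * m + 1) * t) * nuError (X * Real.cos t) := by
  rcases hX.eq_or_lt with rfl | hX0
  · rw [scaledDensity_eq m le_rfl]
    simp
  have hn : (2 * m + 1 : ℝ) ≠ 0 := by positivity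
  have hsum : ∑ r ∈ Finset.Icc 1 ⌊X⌋₊,
      ν r * (√(X ^ 2 - (r : ℝ) ^ 2) * (Polynomial.Chebyshev.U ℝ (2 * m : ℤ)).eval (r / X)) =
      (2 * m + 1) * X * ∫ t in (0 : ℝ)..Real.pi / 2, Real.cos ((2 * m + 1) * t) *
        ∑ r ∈ Finset.Icc 1 ⌊X * Real.cos t⌋₊, ν r := by
    have hV : ∀ t ∈ uIcc 0 (Real.pi / 2), Real.cos ((2 * m + 1) * t) *
        ∑ r ∈ Finset.Icc 1 ⌊X * Real.cos t⌋₊, ν r = ∑ r ∈ Finset.Icc 1 ⌊X⌋₊, ν r *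
          (if (r : ℝ) ≤ X * Real.cos t then Real.cos ((2 * m + 1) * t) else 0) := fun t ht => by
      rw [uIcc_of_le (by positivity)] at ht
      have hc : 0 ≤ Real.cos t :=
        Real.cos_nonneg_of_mem_Icc ⟨by linarith [ht.1, Real.pi_pos], ht.2⟩
      have hle : X * Real.cos t ≤ X := mul_le_of_le_one_right hX (Real.cos_le_one t)
      have hset : Finset.Icc 1 ⌊X * Real.cos t⌋₊ =
          (Finset.Icc 1 ⌊X⌋₊).filter fun r : ℕ => (r : ℝ) ≤ X * Real.cos t := by
        ext r
        simp only [Finset.mem_Icc, Finset.mem_filter]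
        rw [Nat.le_floor_iff (by positivity), Nat.le_floor_iff hX]
        exact ⟨fun h => ⟨⟨h.1, h.2.trans hle⟩, h.2⟩, fun h => ⟨h.1.1, h.2⟩⟩
      rw [hset, Finset.sum_filter, Finset.mul_sum]
      refine Finset.sum_congr rfl fun r _ => ?_
      split_ifs <;> ring
    rw [intervalIntegral.integral_congr hV, intervalIntegral.integral_finsetSum, Finset.mul_sum]
    · refine Finset.sum_congr rfl fun r hr => ?_
      rw [intervalIntegral.integral_const_mul, sqrt_mul_chebyshev_eq m (Nat.cast_nonneg r) hX0
        ((Nat.le_floor_iff hX).mp (Finset.mem_Icc.mp hr).2)]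
      ring
    · intro r _
      refine IntervalIntegrable.const_mul ?_ _
      rw [intervalIntegrable_iff]
      refine MeasureTheory.Measure.integrableOn_of_bounded (M := 1) measure_Ioc_lt_top.ne
        (Measurable.aestronglyMeasurable ?_) (.of_forall fun t => ?_)
      · exact Measurable.ite (measurableSet_le measurable_const (by fun_prop)) (by fun_prop)
          measurable_const
      · split_ifs
        · exact Real.abs_cos_le_one _
        · simp
  have hsplit : ∫ t in (0 : ℝ)..Real.pi / 2, Real.cos ((2 * m + 1) * t) *
        ∑ r ∈ Finset.Icc 1 ⌊X * Real.cos t⌋₊, ν r =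
      (∫ t in (0 : ℝ)..Real.pi / 2, Real.cos ((2 * m + 1) * t) * nuError (X * Real.cos t)) +
      (∑' d : ℕ, nuMob d / d) * X *
        (∫ t in (0 : ℝ)..Real.pi / 2, Real.cos ((2 * m + 1) * t) * Real.cos t) -
      (∑' d, nuMob d) / 2 * ∫ t in (0 : ℝ)..Real.pi / 2, Real.cos ((2 * m + 1) * t) := by
    have h1 := intervalIntegrable_cos_mul_nuError m hX
    rw [← intervalIntegral.integral_const_mul, ← intervalIntegral.integral_const_mul,
      ← intervalIntegral.integral_add h1 (Continuous.intervalIntegrable (by fun_prop) _ _),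
      ← intervalIntegral.integral_sub
        (h1.add (Continuous.intervalIntegrable (by fun_prop) _ _))
        (Continuous.intervalIntegrable (by fun_prop) _ _)]
    refine intervalIntegral.integral_congr fun t _ => ?_
    simp only [nuError]
    ring
  rw [scaledDensity_eq m hX, hsum, hsplit, integral_cos_odd_mul_mul_cos, integral_cos_odd_mul,
    ← alpha_mul_tsum_nuMob]
  have hsq : ((-1 : ℝ) ^ m) * (-1) ^ m = 1 := by rw [← mul_pow]; norm_num
  generalize (∫ t in (0 : ℝ)..Real.pi / 2,
    Real.cos ((2 * m + 1) * t) * nuError (X * Real.cos t)) = I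
  rcases eq_or_ne m 0 with rfl | hm
  · simp only [← alpha_mul_pi_mul_tsum_nuMob_div, if_true]
    norm_num
    ring
  · simp only [hm, if_false]
    field_simp
    linear_combination (-(4 * α * (∑' d, nuMob d))) * hsq

/-- The second primitive of the density in the variable `X`. -/
noncomputable def densityMoment (m : ℕ) (X : ℝ) : ℝ :=
  ∫ u in (0 : ℝ)..X, (X - u) * scaledDensity m u

theorem integral_nuError_mul {X c : ℝ} (hc : 0 < c) :
    ∫ u in (0 : ℝ)..X, (X - u) * u * nuError (u * c) = c⁻¹ ^ 3 * nuErrorMoment (X * c) := by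
  have h := intervalIntegral.integral_comp_mul_right (a := 0) (b := X)
    (fun w => c⁻¹ ^ 2 * ((X * c - w) * w * nuError w)) hc.ne'
  rw [intervalIntegral.integral_const_mul (μ := MeasureTheory.volume) (a := 0 * c), zero_mul,
    smul_eq_mul, ← nuErrorMoment] at h
  rw [pow_succ', mul_assoc, ← h]
  refine intervalIntegral.integral_congr fun w _ => ?_
  field_simp

theorem densityMoment_div_sq (m : ℕ) {X : ℝ} (hX : 0 < X) : densityMoment m X / X ^ 2 =
    α * (-1) ^ m * ∫ t in (0 : ℝ)..Real.pi / 2,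
      cosQuot m t * (nuErrorMoment (X * Real.cos t) / (X * Real.cos t) ^ 2) := by
  have h1 : densityMoment m X = α * (-1) ^ m * ∫ u in (0 : ℝ)..X, ∫ t in (0 : ℝ)..Real.pi / 2,
      (X - u) * u * (Real.cos ((2 * m + 1) * t) * nuError (u * Real.cos t)) := by
    rw [densityMoment, ← intervalIntegral.integral_const_mul]
    refine intervalIntegral.integral_congr fun u hu => ?_
    rw [uIcc_of_le hX.le] at hu
    simp only [scaledDensity_eq_integral m hu.1, intervalIntegral.integral_const_mul]
    ring
  have h2 : ∫ u in (0 : ℝ)..X, ∫ t in (0 : ℝ)..Real.pi / 2,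
        (X - u) * u * (Real.cos ((2 * m + 1) * t) * nuError (u * Real.cos t)) =
      ∫ t in (0 : ℝ)..Real.pi / 2, ∫ u in (0 : ℝ)..X,
        (X - u) * u * (Real.cos ((2 * m + 1) * t) * nuError (u * Real.cos t)) := by
    refine MeasureTheory.intervalIntegral_intervalIntegral_swap ?_
    rw [uIoc_of_le hX.le, uIoc_of_le (by positivity)]
    have hmeas := measurable_nuError
    refine MeasureTheory.IntegrableOn.of_bound (C := X * X * (1 * ∑' d, |nuMob d|)) ?_ ?_ ?_
    · rw [MeasureTheory.Measure.volume_eq_prod, MeasureTheory.Measure.prod_prod]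
      exact ENNReal.mul_lt_top measure_Ioc_lt_top measure_Ioc_lt_top
    · refine Measurable.aestronglyMeasurable ?_
      simp only [Function.uncurry_def]
      have h4 : Measurable fun p : ℝ × ℝ => nuError (p.1 * Real.cos p.2) :=
        hmeas.comp (by fun_prop)
      fun_prop
    · refine (MeasureTheory.ae_restrict_mem
        (measurableSet_Ioc.prod measurableSet_Ioc)).mono ?_
      rintro ⟨u, t⟩ ⟨hu, ht⟩
      have hc : 0 ≤ Real.cos t :=
        Real.cos_nonneg_of_mem_Icc ⟨by linarith [ht.1, Real.pi_pos], ht.2⟩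
      simp only [Function.uncurry_apply_pair, norm_mul, Real.norm_eq_abs]
      rw [abs_of_nonneg (sub_nonneg.mpr hu.2), abs_of_pos hu.1]
      have h4 := sub_nonneg.mpr hu.2
      have h5 := hu.1.le
      gcongr
      · linarith
      · exact hu.2
      · exact Real.abs_cos_le_one _
      · exact abs_nuError_le (by positivity)
  have h3 : ∫ t in (0 : ℝ)..Real.pi / 2, ∫ u in (0 : ℝ)..X,
        (X - u) * u * (Real.cos ((2 * m + 1) * t) * nuError (u * Real.cos t)) =
      X ^ 2 * ∫ t in (0 : ℝ)..Real.pi / 2,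
        cosQuot m t * (nuErrorMoment (X * Real.cos t) / (X * Real.cos t) ^ 2) := by
    rw [← intervalIntegral.integral_const_mul, intervalIntegral.integral_of_le (by positivity),
      intervalIntegral.integral_of_le (by positivity),
      MeasureTheory.integral_Ioc_eq_integral_Ioo, MeasureTheory.integral_Ioc_eq_integral_Ioo]
    refine MeasureTheory.setIntegral_congr_fun measurableSet_Ioo fun t ht => ?_
    have hc : 0 < Real.cos t :=
      Real.cos_pos_of_mem_Ioo ⟨by linarith [ht.1, Real.pi_pos], ht.2⟩
    have h4 : ∀ u : ℝ, (X - u) * u * (Real.cos ((2 * m + 1) * t) * nuError (u * Real.cos t)) =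
        Real.cos ((2 * m + 1) * t) * ((X - u) * u * nuError (u * Real.cos t)) := fun u => by ring
    simp only [h4]
    rw [intervalIntegral.integral_const_mul, integral_nuError_mul hc, ← cos_mul_cosQuot]
    field_simp
  rw [h1, h2, h3]
  field_simp

theorem intervalIntegrable_nuError (a b : ℝ) :
    IntervalIntegrable nuError MeasureTheory.volume a b := by
  refine IntervalIntegrable.mono_fun' (g := fun w => (∑' d, |nuMob d|) +
    (|∑' d : ℕ, nuMob d / d| * |w| + |(∑' d, nuMob d) / 2|))
    (Continuous.intervalIntegrable (by fun_prop) _ _)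
    measurable_nuError.aestronglyMeasurable (.of_forall fun w => ?_)
  have h0 : 0 ≤ ∑' d, |nuMob d| := tsum_nonneg fun _ => abs_nonneg _
  simp only [Real.norm_eq_abs]
  rcases le_total 0 w with hw | hw
  · exact (abs_nuError_le hw).trans (le_add_of_nonneg_right (by positivity))
  · refine le_trans ?_ (le_add_of_nonneg_left h0)
    rw [nuError, Nat.floor_of_nonpos hw, ← abs_mul]
    simp only [Finset.Icc_eq_empty_of_lt zero_lt_one, Finset.sum_empty, zero_sub]
    exact (abs_add_le _ _).trans_eq (by rw [abs_neg])

theorem continuous_nuErrorMoment : Continuous nuErrorMoment := by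
  have h1 : ∀ a b, IntervalIntegrable (fun w => w * nuError w) MeasureTheory.volume a b :=
    fun a b => (intervalIntegrable_nuError a b).continuousOn_mul continuousOn_id
  have h2 : ∀ a b, IntervalIntegrable (fun w => w * (w * nuError w)) MeasureTheory.volume a b :=
    fun a b => (h1 a b).continuousOn_mul continuousOn_id
  have h : nuErrorMoment = fun x => x * (∫ w in (0 : ℝ)..x, w * nuError w) -
      ∫ w in (0 : ℝ)..x, w * (w * nuError w) := by
    ext x
    rw [← intervalIntegral.integral_const_mul,
      ← intervalIntegral.integral_sub ((h1 0 x).const_mul x) (h2 0 x)]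
    exact intervalIntegral.integral_congr fun w _ => by ring
  rw [h]
  exact (continuous_id.mul (intervalIntegral.continuous_primitive h1 0)).sub
    (intervalIntegral.continuous_primitive h2 0)

/-- The density tends to `1/2` in the sense of second Cesàro means. -/
theorem tendsto_densityMoment_div_sq (m : ℕ) :
    Tendsto (fun X => densityMoment m X / X ^ 2) atTop (𝓝 (1 / 4)) := by
  obtain ⟨B, hB⟩ := exists_abs_nuErrorMoment_div_sq_le
  have hmeas := continuous_nuErrorMoment.measurable
  have h := intervalIntegral.tendsto_integral_filter_of_dominated_convergence
    (μ := MeasureTheory.volume) (a := 0) (b := Real.pi / 2) (l := atTop)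
    (F := fun X t => cosQuot m t * (nuErrorMoment (X * Real.cos t) / (X * Real.cos t) ^ 2))
    (f := fun t => cosQuot m t * ((∑' n : ℕ, sqNuMobMob n / n) / 24))
    (fun t => |cosQuot m t| * B) ?_ ?_
    (Continuous.intervalIntegrable ((continuous_cosQuot m).abs.mul_const _) _ _) ?_
  · rw [intervalIntegral.integral_mul_const, integral_cosQuot] at h
    have h' := (h.const_mul (α * (-1) ^ m)).congr' (f₂ := fun X => densityMoment m X / X ^ 2) (by
      filter_upwards [eventually_gt_atTop 0] with X hX
      exact (densityMoment_div_sq m hX).symm)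
    convert h' using 2
    have hsq : ((-1 : ℝ) ^ m) * (-1) ^ m = 1 := by rw [← mul_pow]; norm_num
    have hα := alpha_mul_tsum_sqNuMobMob_div
    have hpi := Real.pi_ne_zero
    calc (1 : ℝ) / 4 = 12 / Real.pi * (Real.pi / 48) := by field_simp; norm_num
      _ = _ := by rw [← hα]; linear_combination (-(α * (∑' n : ℕ, sqNuMobMob n / n) *
                    (Real.pi / 48))) * hsq
  · refine .of_forall fun X => Measurable.aestronglyMeasurable ?_
    have h1 : Measurable fun t => nuErrorMoment (X * Real.cos t) := hmeas.comp (by fun_prop)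
    have h2 := (continuous_cosQuot m).measurable
    fun_prop
  · filter_upwards [eventually_gt_atTop 0] with X hX
    refine .of_forall fun t ht => ?_
    rw [uIoc_of_le (by positivity)] at ht
    rw [norm_mul, Real.norm_eq_abs, Real.norm_eq_abs]
    have hc : 0 ≤ Real.cos t :=
      Real.cos_nonneg_of_mem_Icc ⟨by linarith [ht.1, Real.pi_pos], ht.2⟩
    gcongr
    rcases hc.eq_or_lt with h0 | h0
    · simpa [← h0] using (abs_nonneg _).trans (hB 1 one_pos)
    · exact hB _ (by positivity)
  · have hne : ∀ᵐ t : ℝ, t ≠ Real.pi / 2 := MeasureTheory.Measure.ae_ne _ _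
    filter_upwards [hne] with t ht1 ht
    rw [uIoc_of_le (by positivity)] at ht
    have hc : 0 < Real.cos t :=
      Real.cos_pos_of_mem_Ioo ⟨by linarith [ht.1, Real.pi_pos], lt_of_le_of_ne ht.2 ht1⟩
    exact (tendsto_nuErrorMoment_div_sq.comp (tendsto_id.atTop_mul_const hc)).const_mul _

/-! ### Continuity of the density -/

theorem continuous_density_summand (k : ℤ) {r : ℕ} (hr : 1 ≤ r) :
    Continuous fun y : ℝ => ν r * √(4 * y - (r : ℝ) ^ 2) *
      (Polynomial.Chebyshev.U ℝ k).eval ((r : ℝ) / (2 * √y)) := by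
  have hr1 : (1 : ℝ) ≤ (r : ℝ) ^ 2 := one_le_pow₀ (by exact_mod_cast hr)
  rw [continuous_iff_continuousAt]
  intro y
  rcases lt_or_ge 0 y with hy | hy
  · have h1 : ContinuousAt (fun y : ℝ => (r : ℝ) / (2 * √y)) y :=
      ContinuousAt.div continuousAt_const (by fun_prop)
        (mul_ne_zero two_ne_zero (Real.sqrt_ne_zero'.mpr hy))
    have h2 : ContinuousAt (fun y : ℝ =>
        (Polynomial.Chebyshev.U ℝ k).eval ((r : ℝ) / (2 * √y))) y :=
      (Polynomial.Chebyshev.U ℝ k).continuous.continuousAt.comp h1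
    exact ContinuousAt.mul (by fun_prop) h2
  · -- The square root vanishes near `y ≤ 0`, which makes the division by `√y` harmless.
    refine continuousAt_const.congr (f := fun _ => (0 : ℝ)) ?_
    filter_upwards [Iio_mem_nhds (show y < 1 / 4 by linarith)] with z hz
    rw [Real.sqrt_eq_zero_of_nonpos (by linarith [mem_Iio.mp hz])]
    simp

theorem continuous_density (k : ℕ) : Continuous (density k) := by
  have hsum : Continuous fun y : ℝ => ∑ r ∈ Finset.Icc 1 ⌊2 * √y⌋₊,
      ν r * √(4 * y - (r : ℝ) ^ 2) *
        (Polynomial.Chebyshev.U ℝ ((k : ℤ) - 2)).eval ((r : ℝ) / (2 * √y)) := by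
    rw [continuous_iff_continuousAt]
    intro y
    obtain ⟨N, hN⟩ := exists_nat_gt (2 * √y)
    have hc : Continuous fun y : ℝ => ∑ r ∈ Finset.Icc 1 N, ν r * √(4 * y - (r : ℝ) ^ 2) *
        (Polynomial.Chebyshev.U ℝ ((k : ℤ) - 2)).eval ((r : ℝ) / (2 * √y)) :=
      continuous_finsetSum _ fun r hr =>
        continuous_density_summand _ (Finset.mem_Icc.mp hr).1
    refine hc.continuousAt.congr ?_
    have hcont : Continuous fun y : ℝ => 2 * √y := by fun_prop
    filter_upwards [hcont.continuousAt.eventually (Iio_mem_nhds hN)] with z hz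
    refine (Finset.sum_subset (fun r hr => ?_) fun r hr hr' => ?_).symm
    · rw [Finset.mem_Icc] at hr ⊢
      exact ⟨hr.1, hr.2.trans (Nat.floor_le_of_le (mem_Iio.mp hz).le)⟩
    · rw [Finset.mem_Icc] at hr hr'
      have hlt : 2 * √z < r := Nat.lt_of_floor_lt (by
        by_contra hcon
        exact hr' ⟨hr.1, not_lt.mp hcon⟩)
      have h0 := Real.sqrt_nonneg z
      have : z ≤ √z ^ 2 := by
        rcases le_total 0 z with hz0 | hz0
        · rw [Real.sq_sqrt hz0]
        · exact hz0.trans (sq_nonneg _)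
      rw [Real.sqrt_eq_zero_of_nonpos (by nlinarith)]
      simp
  unfold density
  fun_prop

theorem density_zero (k : ℕ) : density k 0 = 0 := by
  simp [density]

theorem continuous_scaledDensity (m : ℕ) : Continuous (scaledDensity m) :=
  (continuous_density _).comp (by fun_prop)

/-! ### From Cesàro means to smooth averages -/

section

variable {D : ℝ → ℝ}

theorem hasDerivAt_primitive (hD : Continuous D) (X : ℝ) :
    HasDerivAt (fun X => ∫ u in (0 : ℝ)..X, D u) (D X) X :=
  intervalIntegral.integral_hasDerivAt_right (hD.intervalIntegrable _ _)
    (hD.stronglyMeasurableAtFilter _ _) hD.continuousAt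

theorem hasDerivAt_second_primitive (hD : Continuous D) (X : ℝ) :
    HasDerivAt (fun X => ∫ u in (0 : ℝ)..X, (X - u) * D u) (∫ u in (0 : ℝ)..X, D u) X := by
  have h : (fun X => ∫ u in (0 : ℝ)..X, (X - u) * D u) = fun X =>
      X * (∫ u in (0 : ℝ)..X, D u) - ∫ u in (0 : ℝ)..X, u * D u := by
    ext X
    rw [← intervalIntegral.integral_const_mul, ← intervalIntegral.integral_sub
      (Continuous.intervalIntegrable (by fun_prop) _ _)
      (Continuous.intervalIntegrable (by fun_prop) _ _)]
    exact intervalIntegral.integral_congr fun u _ => by ring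
  rw [h]
  exact (((hasDerivAt_id X).mul (hasDerivAt_primitive hD X)).sub
    (hasDerivAt_primitive (D := fun u => u * D u) (by fun_prop) X)).congr_deriv
    (by simp)

theorem integral_mul_comp_mul_eq (hD : Continuous D) {ψ : ℝ → ℂ} (hψ : ContDiff ℝ ∞ ψ)
    (hc : HasCompactSupport ψ) (T : ℝ) :
    (T : ℂ) ^ 2 * ∫ v, ψ v * (D (T * v) : ℂ) =
      ∫ v, deriv (deriv ψ) v * ((∫ u in (0 : ℝ)..T * v, (T * v - u) * D u : ℝ) : ℂ) := by
  set D₁ : ℝ → ℝ := fun X => ∫ u in (0 : ℝ)..X, D u with hD₁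
  set D₂ : ℝ → ℝ := fun X => ∫ u in (0 : ℝ)..X, (X - u) * D u with hD₂
  have hd1 : ∀ X, HasDerivAt D₁ (D X) X := hasDerivAt_primitive hD
  have hd2 : ∀ X, HasDerivAt D₂ (D₁ X) X := hasDerivAt_second_primitive hD
  have hD₁c : Continuous D₁ := continuous_iff_continuousAt.mpr fun X => (hd1 X).continuousAt
  have hD₂c : Continuous D₂ := continuous_iff_continuousAt.mpr fun X => (hd2 X).continuousAt
  have hψ' : ContDiff ℝ ∞ (deriv ψ) := (contDiff_infty_iff_deriv.mp hψ).2
  have hψ'' : ContDiff ℝ ∞ (deriv (deriv ψ)) := (contDiff_infty_iff_deriv.mp hψ').2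
  have hscale : ∀ {F F' : ℝ → ℝ}, (∀ X, HasDerivAt F (F' X) X) → ∀ v,
      HasDerivAt (fun v => ((F (T * v) : ℝ) : ℂ)) ((T : ℂ) * F' (T * v)) v := fun hF v => by
    have h := ((hF (T * v)).comp v ((hasDerivAt_id v).const_mul T)).ofReal_comp
    refine h.congr_deriv ?_
    push_cast
    ring
  have hint : ∀ {χ : ℝ → ℂ} {F : ℝ → ℂ}, Continuous χ → HasCompactSupport χ → Continuous F →
      MeasureTheory.Integrable (χ * F) := fun h1 h2 h3 =>
    (h1.mul h3).integrable_of_hasCompactSupport h2.mul_right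
  have cont : ∀ {F : ℝ → ℝ}, Continuous F → Continuous fun v => ((F (T * v) : ℝ) : ℂ) :=
    fun hF => Complex.continuous_ofReal.comp (hF.comp (continuous_const_mul T))
  have e1 := MeasureTheory.integral_mul_deriv_eq_deriv_mul_of_integrable
    (fun v _ => (hψ.differentiable (by simp) v).hasDerivAt) (fun v _ => hscale hd1 v)
    (hint hψ.continuous hc (continuous_const.mul (cont hD)))
    (hint hψ'.continuous hc.deriv (cont hD₁c)) (hint hψ.continuous hc (cont hD₁c))
  have e2 := MeasureTheory.integral_mul_deriv_eq_deriv_mul_of_integrable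
    (fun v _ => (hψ'.differentiable (by simp) v).hasDerivAt) (fun v _ => hscale hd2 v)
    (hint hψ'.continuous hc.deriv (continuous_const.mul (cont hD₁c)))
    (hint hψ''.continuous hc.deriv.deriv (cont hD₂c)) (hint hψ'.continuous hc.deriv (cont hD₂c))
  have a1 : ∀ v, ψ v * ((T : ℂ) * D (T * v)) = T * (ψ v * D (T * v)) := fun v => by ring
  have a2 : ∀ v, deriv ψ v * ((T : ℂ) * D₁ (T * v)) = T * (deriv ψ v * D₁ (T * v)) :=
    fun v => by ring
  simp only [a1, MeasureTheory.integral_const_mul] at e1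
  simp only [a2, MeasureTheory.integral_const_mul] at e2
  linear_combination (T : ℂ) * e1 - e2

/-- If the second Cesàro means of `D` converge to `L`, then so do the averages of `D (T v)`
against a smooth weight supported in `(0, ∞)`. -/
theorem tendsto_integral_of_cesaro (hD : Continuous D) {L : ℝ}
    (hL : Tendsto (fun X => (∫ u in (0 : ℝ)..X, (X - u) * D u) / X ^ 2) atTop (𝓝 (L / 2)))
    {ψ : ℝ → ℂ} (hψ : ContDiff ℝ ∞ ψ) (hc : HasCompactSupport ψ) {a : ℝ} (ha : 0 < a)
    (hψa : ∀ v < a, ψ v = 0) :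
    Tendsto (fun T : ℝ => ∫ v, ψ v * (D (T * v) : ℂ)) atTop (𝓝 (L * ∫ v, ψ v)) := by
  have hψ' : ContDiff ℝ ∞ (deriv ψ) := (contDiff_infty_iff_deriv.mp hψ).2
  have hψ'' : ContDiff ℝ ∞ (deriv (deriv ψ)) := (contDiff_infty_iff_deriv.mp hψ').2
  have hz : ∀ v < a, deriv (deriv ψ) v = 0 := fun v hv => by
    have h1 : ψ =ᶠ[𝓝 v] fun _ => 0 := by
      filter_upwards [Iio_mem_nhds hv] with w hw using hψa w hw
    simpa using h1.deriv.deriv_eq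
  have hD₂c : Continuous fun X => ∫ u in (0 : ℝ)..X, (X - u) * D u :=
    continuous_iff_continuousAt.mpr fun X => (hasDerivAt_second_primitive hD X).continuousAt
  -- The limit is evaluated by the same identity, for the constant function `L` and `T = 1`.
  have hone : ∫ v, deriv (deriv ψ) v * ((L / 2 * v ^ 2 : ℝ) : ℂ) = L * ∫ v, ψ v := by
    have h := integral_mul_comp_mul_eq (D := fun _ => L) continuous_const hψ hc 1
    have e : ∀ v : ℝ, ∫ u in (0 : ℝ)..v, (v - u) * L = L / 2 * v ^ 2 := fun v => by
      rw [intervalIntegral.integral_mul_const, intervalIntegral.integral_sub (by simp) (by simp)]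
      simp
      ring
    simp only [one_mul, e] at h
    rw [← h, MeasureTheory.integral_mul_const]
    push_cast
    ring
  rw [← hone]
  have key : Tendsto (fun T : ℝ => ∫ v, deriv (deriv ψ) v *
      (((∫ u in (0 : ℝ)..T * v, (T * v - u) * D u) / T ^ 2 : ℝ) : ℂ)) atTop
      (𝓝 (∫ v, deriv (deriv ψ) v * ((L / 2 * v ^ 2 : ℝ) : ℂ))) := by
    have hB : ∀ᶠ X : ℝ in atTop,
        |(∫ u in (0 : ℝ)..X, (X - u) * D u) / X ^ 2| ≤ |L / 2| + 1 :=
      (hL.abs.eventually (Iio_mem_nhds (lt_add_one _))).mono fun _ h => (mem_Iio.mp h).le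
    obtain ⟨X₀, hX₀⟩ := eventually_atTop.mp hB
    refine MeasureTheory.tendsto_integral_filter_of_dominated_convergence
      (fun v => ‖deriv (deriv ψ) v * (((|L / 2| + 1) * v ^ 2 : ℝ) : ℂ)‖) ?_ ?_ ?_ ?_
    · refine .of_forall fun T => Continuous.aestronglyMeasurable ?_
      exact hψ''.continuous.mul (Complex.continuous_ofReal.comp
        ((hD₂c.comp (continuous_const_mul T)).div_const _))
    · filter_upwards [eventually_ge_atTop (X₀ / a), eventually_gt_atTop 0] with T hT hT0
      refine .of_forall fun v => ?_
      rcases lt_or_ge v a with hv | hv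
      · simp [hz v hv]
      · have hX : X₀ ≤ T * v := by
          rw [div_le_iff₀ ha] at hT
          exact hT.trans (by gcongr)
        have hv0 : 0 < v := ha.trans_le hv
        rw [norm_mul, norm_mul, Complex.norm_real, Complex.norm_real, Real.norm_eq_abs,
          Real.norm_eq_abs, abs_of_nonneg (by positivity : 0 ≤ (|L / 2| + 1) * v ^ 2)]
        gcongr
        calc |(∫ u in (0 : ℝ)..T * v, (T * v - u) * D u) / T ^ 2|
            = |(∫ u in (0 : ℝ)..T * v, (T * v - u) * D u) / (T * v) ^ 2| * v ^ 2 := by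
              rw [abs_div, abs_div, abs_of_pos (by positivity : 0 < T ^ 2),
                abs_of_pos (by positivity : 0 < (T * v) ^ 2)]
              field_simp
          _ ≤ _ := by gcongr; exact hX₀ _ hX
    · refine MeasureTheory.Integrable.norm ?_
      refine Continuous.integrable_of_hasCompactSupport ?_ hc.deriv.deriv.mul_right
      exact hψ''.continuous.mul (by fun_prop)
    · refine .of_forall fun v => ?_
      rcases lt_or_ge v a with hv | hv
      · simp [hz v hv]
      · have hv0 : 0 < v := ha.trans_le hv
        refine Tendsto.const_mul _ ((Complex.continuous_ofReal.tendsto _).comp ?_)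
        have h := (hL.comp (tendsto_id.atTop_mul_const hv0)).mul_const (v ^ 2)
        refine h.congr fun T => ?_
        simp only [Function.comp, id]
        field_simp
  refine key.congr' ?_
  filter_upwards [eventually_gt_atTop 0] with T hT
  have hT' : (T : ℂ) ≠ 0 := by exact_mod_cast hT.ne'
  have h := integral_mul_comp_mul_eq hD hψ hc T
  rw [← mul_right_inj' (pow_ne_zero 2 hT'), h, ← MeasureTheory.integral_const_mul]
  refine MeasureTheory.integral_congr_ae (.of_forall fun v => ?_)
  simp only
  push_cast
  field_simp

end

/-! ### The smoothed density -/

/-- The weight `Φ(u) u du` on `(0, ∞)`, pulled back along `u = v⁻²` and extended by zero. -/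
noncomputable def pulledWeight (Φ : ℝ → ℂ) (v : ℝ) : ℂ :=
  if 0 < v then (2 * v⁻¹ ^ 5 : ℝ) • Φ (v⁻¹ ^ 2) else 0

theorem integral_mul_pulledWeight (Φ F : ℝ → ℂ) :
    ∫ u in Ioi (0 : ℝ), F u * Φ u * (u : ℂ) = ∫ v, pulledWeight Φ v * F (v⁻¹ ^ 2) := by
  have h := MeasureTheory.integral_comp_rpow_Ioi (fun u => F u * Φ u * (u : ℂ))
    (show (-2 : ℝ) ≠ 0 by norm_num)
  rw [← h, ← MeasureTheory.setIntegral_eq_integral_of_forall_compl_eq_zero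
    (f := fun v => pulledWeight Φ v * F (v⁻¹ ^ 2)) (s := Ioi (0 : ℝ))]
  · refine MeasureTheory.setIntegral_congr_fun measurableSet_Ioi fun v hv => ?_
    have hv0 : 0 < v := hv
    have h2 : v ^ (-2 : ℝ) = v⁻¹ ^ 2 := by
      rw [Real.rpow_neg hv0.le, Real.rpow_two, inv_pow]
    have h3 : v ^ (-2 - 1 : ℝ) = v⁻¹ ^ 3 := by
      rw [show (-2 - 1 : ℝ) = -((3 : ℕ) : ℝ) by norm_num, Real.rpow_neg hv0.le,
        Real.rpow_natCast, inv_pow]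
    simp only [h2, h3, pulledWeight, hv0, if_true, Complex.real_smul, abs_neg, abs_two]
    push_cast
    ring
  · intro v hv
    have : ¬ 0 < v := hv
    simp [pulledWeight, this]

section

variable {Φ : ℝ → ℂ}

theorem exists_support_bounds (hΦc : HasCompactSupport Φ) (hΦs : tsupport Φ ⊆ Ioi 0) :
    ∃ a b : ℝ, 0 < a ∧ a ≤ 1 ∧ 1 ≤ b ∧ (∀ u < a, Φ u = 0) ∧ ∀ u, b < u → Φ u = 0 := by
  obtain ⟨b, hb⟩ := hΦc.isCompact.bddAbove
  have h0 : (0 : ℝ) ∉ tsupport Φ := fun h => lt_irrefl (0 : ℝ) (hΦs h)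
  obtain ⟨a, ha, hball⟩ := Metric.eventually_nhds_iff.mp (notMem_tsupport_iff_eventuallyEq.mp h0)
  refine ⟨min a 1, max b 1, lt_min ha one_pos, min_le_right _ _, le_max_right _ _,
    fun u hu => ?_, fun u hu => ?_⟩
  · rcases le_or_gt u 0 with hu0 | hu0
    · exact image_eq_zero_of_notMem_tsupport fun h => absurd (hΦs h) (not_lt.mpr hu0)
    · refine hball ?_
      rw [dist_zero_right, Real.norm_of_nonneg hu0.le]
      exact hu.trans_le (min_le_left _ _)
  · exact image_eq_zero_of_notMem_tsupport fun h =>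
      absurd (hb h) (not_le.mpr ((le_max_left _ _).trans_lt hu))

theorem pulledWeight_eq_zero_of_lt {b : ℝ} (hb : 1 ≤ b) (hΦ : ∀ u, b < u → Φ u = 0) {v : ℝ}
    (hv : v < b⁻¹) : pulledWeight Φ v = 0 := by
  rw [pulledWeight]
  split_ifs with h0
  · have h1 : b < v⁻¹ := (lt_inv_comm₀ h0 (by linarith)).mp hv
    rw [hΦ _ (by nlinarith), smul_zero]
  · rfl

theorem pulledWeight_eq_zero_of_gt {a : ℝ} (ha : 0 < a) (ha1 : a ≤ 1) (hΦ : ∀ u < a, Φ u = 0)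
    {v : ℝ} (hv : a⁻¹ < v) : pulledWeight Φ v = 0 := by
  have h0 : 0 < v := (inv_pos.mpr ha).trans hv
  have h1 : v⁻¹ < a := (inv_lt_comm₀ ha h0).mp hv
  have h2 : 0 < v⁻¹ := inv_pos.mpr h0
  rw [pulledWeight, if_pos h0, hΦ _ (by nlinarith), smul_zero]

theorem contDiff_pulledWeight (hΦ : ContDiff ℝ ∞ Φ) {b : ℝ} (hb : 1 ≤ b)
    (hΦb : ∀ u, b < u → Φ u = 0) : ContDiff ℝ ∞ (pulledWeight Φ) := by
  rw [contDiff_iff_contDiffAt]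
  intro v
  rcases lt_or_ge v b⁻¹ with hv | hv
  · refine (contDiffAt_const (c := (0 : ℂ))).congr_of_eventuallyEq ?_
    filter_upwards [Iio_mem_nhds hv] with w hw using pulledWeight_eq_zero_of_lt hb hΦb hw
  · have hv0 : 0 < v := (inv_pos.mpr (by linarith)).trans_le hv
    have h : ContDiffAt ℝ ∞ (fun v : ℝ => (2 * v⁻¹ ^ 5 : ℝ) • Φ (v⁻¹ ^ 2)) v := by
      have hi : ContDiffAt ℝ ∞ (fun v : ℝ => v⁻¹) v := contDiffAt_inv ℝ hv0.ne'
      exact (contDiffAt_const.mul (hi.pow 5)).smul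
        (hΦ.contDiffAt.comp v (hi.pow 2))
    refine h.congr_of_eventuallyEq ?_
    filter_upwards [Ioi_mem_nhds hv0] with w hw
    exact if_pos hw

theorem hasCompactSupport_pulledWeight {a b : ℝ} (ha : 0 < a) (ha1 : a ≤ 1) (hb : 1 ≤ b)
    (hΦa : ∀ u < a, Φ u = 0) (hΦb : ∀ u, b < u → Φ u = 0) :
    HasCompactSupport (pulledWeight Φ) := by
  refine HasCompactSupport.intro (isCompact_Icc (a := b⁻¹) (b := a⁻¹)) fun v hv => ?_
  rw [mem_Icc, not_and_or, not_le, not_le] at hv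
  exact hv.elim (pulledWeight_eq_zero_of_lt hb hΦb) (pulledWeight_eq_zero_of_gt ha ha1 hΦa)

theorem continuous_smoothedDensity (k : ℕ) (hΦ : Continuous Φ) {a b : ℝ} (ha : 0 < a)
    (hΦa : ∀ u < a, Φ u = 0) (hΦb : ∀ u, b < u → Φ u = 0) :
    Continuous (smoothedDensity k Φ) := by
  refine Continuous.div_const ?_ _
  have h : (fun y : ℝ => ∫ u in Ioi (0 : ℝ), (density k (y / u) : ℂ) * Φ u * (u : ℂ)) =
      fun y => ∫ u in Icc a b, (density k (y / max a u) : ℂ) * Φ u * (u : ℂ) := by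
    ext y
    rw [← MeasureTheory.integral_indicator measurableSet_Ioi,
      ← MeasureTheory.integral_indicator measurableSet_Icc]
    congr 1
    ext u
    by_cases hu : u ∈ Icc a b
    · rw [indicator_of_mem hu, indicator_of_mem (show u ∈ Ioi 0 from ha.trans_le hu.1),
        max_eq_right hu.1]
    · rw [indicator_of_notMem hu]
      have : Φ u = 0 := by
        rw [mem_Icc, not_and_or, not_le, not_le] at hu
        exact hu.elim (hΦa u) (hΦb u)
      simp [indicator_apply, this]
  rw [h]
  refine continuous_parametric_integral_of_continuous ?_ isCompact_Icc
  have hd : Continuous fun p : ℝ × ℝ => p.1 / max a p.2 :=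
    continuous_fst.div (by fun_prop) fun p => (ha.trans_le (le_max_left _ _)).ne'
  have hdens := (continuous_density k).comp hd
  simp only [Function.uncurry_def]
  exact ((Complex.continuous_ofReal.comp hdens).mul (hΦ.comp continuous_snd)).mul (by fun_prop)

theorem smoothedDensity_eq (m : ℕ) {y : ℝ} (hy : 0 ≤ y) : smoothedDensity (2 * m + 2) Φ y =
    (∫ v, pulledWeight Φ v * (scaledDensity m (2 * √y * v) : ℂ)) / ∫ v, pulledWeight Φ v := by
  have h1 := integral_mul_pulledWeight Φ fun u => (density (2 * m + 2) (y / u) : ℂ)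
  have h2 := integral_mul_pulledWeight Φ fun _ => 1
  simp only [one_mul, mul_one] at h2
  rw [smoothedDensity, h1, h2]
  congr 2
  ext v
  have : y / v⁻¹ ^ 2 = (2 * √y * v) ^ 2 / 4 := by
    rw [inv_pow, div_inv_eq_mul, mul_pow, mul_pow, Real.sq_sqrt hy]
    ring
  rw [this, scaledDensity]

end

end Murmuration

theorem theorem5 (k : ℕ) (hk : Even k) (hk0 : 0 < k)
    (Φ : ℝ → ℂ) (hΦ : ContDiff ℝ ∞ Φ) (hΦc : HasCompactSupport Φ) (hΦs : tsupport Φ ⊆ Ioi 0)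
    (hΦ0 : (∫ u in Ioi (0 : ℝ), Φ u * (u : ℂ)) ≠ 0) :
    ContinuousOn (Murmuration.smoothedDensity k Φ) (Ici 0) ∧
      Murmuration.smoothedDensity k Φ 0 = 0 ∧
      Tendsto (Murmuration.smoothedDensity k Φ) atTop (𝓝 (1 / 2)) := by
  open Murmuration in
  obtain ⟨a, b, ha, ha1, hb, hΦa, hΦb⟩ := exists_support_bounds hΦc hΦs
  refine ⟨(continuous_smoothedDensity k hΦ.continuous ha hΦa hΦb).continuousOn, ?_, ?_⟩
  · simp [smoothedDensity, density_zero]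
  obtain ⟨m, rfl⟩ : ∃ m, k = 2 * m + 2 := by
    obtain ⟨j, rfl⟩ := hk
    exact ⟨j - 1, by omega⟩
  have hne : ∫ v, pulledWeight Φ v ≠ 0 := by
    have h2 := integral_mul_pulledWeight Φ fun _ => 1
    simp only [one_mul, mul_one] at h2
    rwa [← h2]
  have h := tendsto_integral_of_cesaro (continuous_scaledDensity m) (L := 1 / 2)
    ((tendsto_densityMoment_div_sq m).trans (by norm_num)) (contDiff_pulledWeight hΦ hb hΦb)
    (hasCompactSupport_pulledWeight ha ha1 hb hΦa hΦb) (inv_pos.mpr (by linarith))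
    fun v hv => pulledWeight_eq_zero_of_lt hb hΦb hv
  have hT : Tendsto (fun y : ℝ => 2 * √y) atTop atTop :=
    Real.tendsto_sqrt_atTop.const_mul_atTop two_pos
  have h' := (h.comp hT).div_const (∫ v, pulledWeight Φ v)
  rw [mul_div_cancel_right₀ _ hne] at h'
  norm_num at h'
  refine (h'.congr' ?_).trans (by norm_num)
  filter_upwards [eventually_ge_atTop 0] with y hy
  exact (smoothedDensity_eq m hy).symm
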